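/- Let $M$ be a compact connected smooth (Hausdorff, boundaryless) manifold of real dimension $2n$, and let $J$ be a smooth almost complex structure on $M$; write $X=(M,J)$. Suppose $v_1,w_1,\dots,v_n,w_n$ are smooth vector fields on $M$ that form a basis of $T_xM$ at every $x\in M$ and in which $J$ is in standard form: $Jv_i=w_i$ and $Jw_i=-v_i$ for $i=1,\dots,n$. Let $v^1,w^1,\dots,v^n,w^n$ be the dual coframe, put $\varphi^i=v^i+\sqrt{-1}\,w^i$, and let $\psi=\varphi^1\wedge\dots\wedge\varphi^n$, a smooth section of the canonical bundle $\omega_X=\Lambda^{n,0}$. Let $\bar\partial:\Gamma(\omega_X)\to\Gamma(\Lambda^{0,1}\otimes\omega_X)$ be the $(n,1)$-component of the exterior derivative $d$, extended to $\omega_X^{\otimes m}$ by the Leibniz rule. Let $H^0(X,\mathcal O_X)$ be the space of smooth functions $f:M\to\mathbb C$ with $\bar\partial f=0$, where $\bar\partial f$ is the $(0,1)$-part of $df$. For $m\ge 1$ let $H^0(X,\omega_X^{\otimes m})$ be the space of smooth sections $s$ of $\omega_X^{\otimes m}$ with $\bar\partial s=0$, and let $P_m(X)=\dim_{\mathbb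 C}H^0(X,\omega_X^{\otimes m})$. Let $\mathrm{kod}(X)=-\infty$ if $P_m(X)=0$ for all $m\ge1$, and $\mathrm{kod}(X)=\limsup_{m\to\infty}\frac{\log P_m(X)}{\log m}$ otherwise. If $\bar\partial\psi=0$, then for every $m\ge 1$ the map $f\mapsto f\,\psi^{\otimes m}$ is a $\mathbb C$-linear isomorphism from $H^0(X,\mathcal O_X)$ onto $H^0(X,\omega_X^{\otimes m})$, and $P_m(X)=1$. Consequently $\mathrm{kod}(X)=0$. -/

import Mathlib

open Set Filter Topology Function
open scoped Manifold ContDiff TensorProduct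

noncomputable section

namespace AlmostComplex

/-! ### Linear algebra: complex-valued alternating forms on a real space with `J ^ 2 = -1` -/

section LinearAlgebra

variable {V : Type*} [AddCommGroup V] [Module ℝ V] [TopologicalSpace V]

/-- The space `Λ^{k,0}` of forms of type `(k,0)`: the complex-valued real-multilinear alternating
forms that are complex linear in every slot, where `i` acts on `V` as `J`. -/
def typeZero (J : V →L[ℝ] V) (k : ℕ) : Submodule ℂ (V [⋀^Fin k]→L[ℝ] ℂ) where
  carrier := {η | ∀ (w : Fin k → V) (i : Fin k),
    η (update w i (J (w i))) = Complex.I * η w}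
  add_mem' := by
    intro a b ha hb w i
    simp only [ContinuousAlternatingMap.add_apply, ha w i, hb w i, mul_add]
  zero_mem' := by
    intro w i
    simp
  smul_mem' := by
    intro c a ha w i
    simp only [ContinuousAlternatingMap.smul_apply, ha w i, smul_eq_mul]
    ring

/-- The wedge product `φ¹ ∧ … ∧ φᵏ` of complex-valued one-forms,
`(w₁, …, w_k) ↦ det (φⁱ (w_j))`. -/
def wedge {k : ℕ} (φ : Fin k → V →L[ℝ] ℂ) : V [⋀^Fin k]→L[ℝ] ℂ where
  toFun w := (Matrix.of fun j i => φ i (w j)).det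
  map_update_add' := by
    intro inst w j x y
    obtain rfl : inst = instDecidableEqFin k := Subsingleton.elim _ _
    have h : ∀ z : V, (Matrix.of fun a i => φ i (update w j z a))
        = Matrix.updateRow (Matrix.of fun a i => φ i (w a)) j (fun i => φ i z) := by
      intro z
      ext a i
      by_cases h : a = j
      · subst h; simp
      · simp [h]
    rw [h, h, h, ← Matrix.det_updateRow_add]
    congr 2
    ext i
    simp
  map_update_smul' := by
    intro inst w j c x
    obtain rfl : inst = instDecidableEqFin k := Subsingleton.elim _ _
    have h : ∀ z : V, (Matrix.of fun a i => φ i (update w j z a))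
        = Matrix.updateRow (Matrix.of fun a i => φ i (w a)) j (fun i => φ i z) := by
      intro z
      ext a i
      by_cases h : a = j
      · subst h; simp
      · simp [h]
    have h2 : (fun i => φ i (c • x)) = (c : ℂ) • (fun i => φ i x) := by
      ext i
      simp
    rw [h, h, h2, Matrix.det_updateRow_smul]
    simp
  map_eq_zero_of_eq' := by
    intro w i j hw hij
    exact Matrix.det_zero_of_row_eq hij (by ext a; simp [hw])
  cont := by
    refine Continuous.matrix_det ?_
    refine continuous_matrix fun a b => ?_
    exact (φ b).continuous.comp (continuous_apply a)

theorem wedge_apply {k : ℕ} (φ : Fin k → V →L[ℝ] ℂ) (w : Fin k → V) :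
    wedge φ w = (Matrix.of fun j i => φ i (w j)).det := rfl

theorem wedge_mem_typeZero {k : ℕ} {J : V →L[ℝ] V} {φ : Fin k → V →L[ℝ] ℂ}
    (h : ∀ i v, φ i (J v) = Complex.I * φ i v) : wedge φ ∈ typeZero J k := by
  intro w j
  rw [wedge_apply, wedge_apply]
  have h1 : (Matrix.of fun a i => φ i (update w j (J (w j)) a))
      = Matrix.updateRow (Matrix.of fun a i => φ i (w a)) j
          (Complex.I • fun i => φ i (w j)) := by
    ext a i
    by_cases h' : a = j
    · subst h'; simp [h]
    · simp [h']
  rw [h1, Matrix.det_updateRow_smul]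
  congr 2
  ext a i
  by_cases h' : a = j
  · subst h'; simp
  · simp [h']

/-- Interior product with a real vector: `(ι_v η)(w₁, …, w_k) = η(v, w₁, …, w_k)`. -/
def interiorMul {k : ℕ} (η : V [⋀^Fin (k + 1)]→L[ℝ] ℂ) (v : V) : V [⋀^Fin k]→L[ℝ] ℂ where
  __ := η.toAlternatingMap.curryLeft v
  cont := η.cont.comp (continuous_const.finCons continuous_id)

/-- Interior product with the `(0,1)`-part `v^{0,1} = (v + i J v) / 2` of a real vector `v`,
the form `η` being extended complex-multilinearly. -/
def interiorZeroOne (J : V →L[ℝ] V) {k : ℕ} (η : V [⋀^Fin (k + 1)]→L[ℝ] ℂ) (v : V) :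
    V [⋀^Fin k]→L[ℝ] ℂ :=
  (1 / 2 : ℂ) • (interiorMul η v + Complex.I • interiorMul η (J v))

/-- The argument `w` with `J` applied in the slots belonging to `T`. -/
def applyOn (J : V →L[ℝ] V) {k : ℕ} (T : Finset (Fin k)) (w : Fin k → V) : Fin k → V :=
  fun j => if j ∈ T then J (w j) else w j

theorem holoSum_swap (J : V →L[ℝ] V) {k : ℕ} (η : V [⋀^Fin k]→L[ℝ] ℂ) (w : Fin k → V)
    (a b : Fin k) (hw : w a = w b) (hab : a ≠ b) :
    ∑ T : Finset (Fin k), (-Complex.I) ^ T.card * η (applyOn J T w) = 0 := by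
  have key : ∑ T : Finset (Fin k), (-Complex.I) ^ T.card * η (applyOn J T w)
      = ∑ T : Finset (Fin k), -((-Complex.I) ^ T.card * η (applyOn J T w)) := by
    refine Fintype.sum_equiv (Equiv.finsetCongr (Equiv.swap a b)) _ _ fun T => ?_
    have h1 : applyOn J (Equiv.finsetCongr (Equiv.swap a b) T) w
        = applyOn J T w ∘ Equiv.swap a b := by
      ext1 j
      have hwj : w (Equiv.swap a b j) = w j := by
        by_cases h1 : j = a
        · subst h1; simp [hw]
        · by_cases h2 : j = b
          · subst h2; simp [hw]
          · rw [Equiv.swap_apply_of_ne_of_ne h1 h2]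
      have hmem : j ∈ Equiv.finsetCongr (Equiv.swap a b) T ↔ Equiv.swap a b j ∈ T := by
        simp only [Equiv.finsetCongr_apply, Finset.mem_map_equiv, Equiv.symm_swap]
      simp only [applyOn, comp_apply, hwj, hmem]
    have h2 : η (applyOn J T w ∘ Equiv.swap a b) = -η (applyOn J T w) :=
      η.toAlternatingMap.map_swap _ hab
    rw [h1, h2]
    simp
  rw [Finset.sum_neg_distrib] at key
  exact self_eq_neg.mp key

/-- The `(k,0)`-component of a complex-valued `k`-form `η`: the form
`(w₁, …, w_k) ↦ η(w₁^{1,0}, …, w_k^{1,0})`, where `w^{1,0} = (w - i J w) / 2` and `η` is extended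
complex-multilinearly. Expanding the product gives the sum over the set `T` of slots that
receive `J`. -/
def holoPart (J : V →L[ℝ] V) {k : ℕ} (η : V [⋀^Fin k]→L[ℝ] ℂ) : V [⋀^Fin k]→L[ℝ] ℂ where
  toFun w := (1 / 2 : ℂ) ^ k *
    ∑ T : Finset (Fin k), (-Complex.I) ^ T.card * η (applyOn J T w)
  map_update_add' := by
    intro inst w j x y
    obtain rfl : inst = instDecidableEqFin k := Subsingleton.elim _ _
    have h : ∀ (T : Finset (Fin k)) (z : V), applyOn J T (update w j z)
        = update (applyOn J T w) j (if j ∈ T then J z else z) := by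
      intro T z
      ext1 a
      by_cases h : a = j
      · subst h; simp [applyOn]
      · simp [applyOn, h]
    rw [← mul_add, ← Finset.sum_add_distrib]
    congr 1
    refine Finset.sum_congr rfl fun T _ => ?_
    rw [h, h, h, ← mul_add]
    congr 1
    split_ifs
    · rw [map_add, η.map_update_add]
    · rw [η.map_update_add]
  map_update_smul' := by
    intro inst w j c x
    obtain rfl : inst = instDecidableEqFin k := Subsingleton.elim _ _
    have h : ∀ (T : Finset (Fin k)) (z : V), applyOn J T (update w j z)
        = update (applyOn J T w) j (if j ∈ T then J z else z) := by
      intro T z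
      ext1 a
      by_cases h : a = j
      · subst h; simp [applyOn]
      · simp [applyOn, h]
    rw [← mul_smul_comm, Finset.smul_sum]
    congr 1
    refine Finset.sum_congr rfl fun T _ => ?_
    rw [h, h, ← mul_smul_comm]
    congr 1
    split_ifs
    · rw [map_smul, η.map_update_smul]
    · rw [η.map_update_smul]
  map_eq_zero_of_eq' := by
    intro w a b hw hab
    change _ * (∑ T : Finset (Fin k), (-Complex.I) ^ T.card * η (applyOn J T w)) = 0
    rw [holoSum_swap J η w a b hw hab, mul_zero]
  cont := by
    refine continuous_const.mul (continuous_finsetSum _ fun T _ => continuous_const.mul ?_)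
    refine η.cont.comp (continuous_pi fun j => ?_)
    by_cases h : j ∈ T
    · simp only [applyOn, h, if_true]
      exact J.continuous.comp (continuous_apply j)
    · simp only [applyOn, h, if_false]
      exact continuous_apply j

theorem holoPart_apply (J : V →L[ℝ] V) {k : ℕ} (η : V [⋀^Fin k]→L[ℝ] ℂ) (w : Fin k → V) :
    holoPart J η w = (1 / 2 : ℂ) ^ k *
      ∑ T : Finset (Fin k), (-Complex.I) ^ T.card * η (applyOn J T w) := rfl

theorem holoPart_mem_typeZero {J : V →L[ℝ] V} (hJ : ∀ v, J (J v) = -v) {k : ℕ}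
    (η : V [⋀^Fin k]→L[ℝ] ℂ) : holoPart J η ∈ typeZero J k := by
  intro w i
  rw [holoPart_apply, holoPart_apply, mul_left_comm]
  congr 1
  rw [Finset.mul_sum]
  refine Finset.sum_bij' (fun (T : Finset (Fin k)) _ => if i ∈ T then T.erase i else insert i T)
    (fun (T : Finset (Fin k)) _ => if i ∈ T then T.erase i else insert i T)
    (fun _ _ => Finset.mem_univ _) (fun _ _ => Finset.mem_univ _) ?_ ?_ ?_
  · intro T _
    by_cases h : i ∈ T <;> simp [h]
  · intro T _
    by_cases h : i ∈ T <;> simp [h]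
  · intro T _
    by_cases h : i ∈ T
    · have h1 : applyOn J T (update w i (J (w i)))
          = update (applyOn J (T.erase i) w) i (-(applyOn J (T.erase i) w i)) := by
        ext1 a
        by_cases h' : a = i
        · subst h'; simp [applyOn, h, hJ]
        · simp [applyOn, h']
      have h2 : η (update (applyOn J (T.erase i) w) i (-(applyOn J (T.erase i) w i)))
          = - η (applyOn J (T.erase i) w) := by
        have := η.map_update_smul (applyOn J (T.erase i) w) i (-1 : ℝ)
          (applyOn J (T.erase i) w i)
        simpa using this
      have h3 : T.card = (T.erase i).card + 1 := (Finset.card_erase_add_one h).symm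
      simp only [h, if_true]
      rw [h1, h2, h3, pow_succ]
      ring
    · have h1 : applyOn J T (update w i (J (w i))) = applyOn J (insert i T) w := by
        ext1 a
        by_cases h' : a = i
        · subst h'; simp [applyOn, h]
        · simp [applyOn, h']
      have h3 : (insert i T).card = T.card + 1 := Finset.card_insert_of_notMem h
      simp only [h, if_false]
      rw [h1, h3, pow_succ]
      linear_combination ((-Complex.I) ^ T.card * η (applyOn J (insert i T) w)) * Complex.I_mul_I

end LinearAlgebra

/-! ### Almost complex manifolds of real dimension `2 n` -/

section Manifold

variable {n : ℕ} {M : Type*} [TopologicalSpace M]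
  [ChartedSpace (EuclideanSpace ℝ (Fin (2 * n))) M]

variable (n M) in
/-- An almost complex structure on a smooth manifold `M` of real dimension `2 n`: a smooth
endomorphism `J` of the tangent bundle with `J ^ 2 = -1`. -/
structure AlmostComplexStructure [IsManifold (𝓡 (2 * n)) ∞ M] where
  toFun : ∀ x : M, TangentSpace (𝓡 (2 * n)) x →L[ℝ] TangentSpace (𝓡 (2 * n)) x
  smooth : ContMDiff (𝓡 (2 * n))
    ((𝓡 (2 * n)).prod
      𝓘(ℝ, EuclideanSpace ℝ (Fin (2 * n)) →L[ℝ] EuclideanSpace ℝ (Fin (2 * n)))) ∞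
    (fun x => Bundle.TotalSpace.mk'
      (EuclideanSpace ℝ (Fin (2 * n)) →L[ℝ] EuclideanSpace ℝ (Fin (2 * n)))
      (E := fun x : M => TangentSpace (𝓡 (2 * n)) x →L[ℝ] TangentSpace (𝓡 (2 * n)) x)
      x (toFun x))
  sq : ∀ (x : M) (v : TangentSpace (𝓡 (2 * n)) x), toFun x (toFun x v) = -v

/-- The coordinate expression of a complex-valued `k`-form in the chart around `x₀`. -/
def formInChart {k : ℕ} (η : ∀ x : M, TangentSpace (𝓡 (2 * n)) x [⋀^Fin k]→L[ℝ] ℂ) (x₀ : M)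
    (y : EuclideanSpace ℝ (Fin (2 * n))) :
    EuclideanSpace ℝ (Fin (2 * n)) [⋀^Fin k]→L[ℝ] ℂ :=
  (η ((extChartAt (𝓡 (2 * n)) x₀).symm y)).compContinuousLinearMap
    (mfderiv 𝓘(ℝ, EuclideanSpace ℝ (Fin (2 * n))) (𝓡 (2 * n)) (extChartAt (𝓡 (2 * n)) x₀).symm y)

/-- A complex-valued `k`-form is smooth on `U` if its coordinate expressions are. -/
def IsSmoothFormOn {k : ℕ} (η : ∀ x : M, TangentSpace (𝓡 (2 * n)) x [⋀^Fin k]→L[ℝ] ℂ)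
    (U : Set M) : Prop :=
  ∀ x₀ : M, ContDiffOn ℝ ∞ (formInChart η x₀)
    ((extChartAt (𝓡 (2 * n)) x₀).target ∩ (extChartAt (𝓡 (2 * n)) x₀).symm ⁻¹' U)

/-- The exterior derivative `dη` at `x`, computed in the chart around `x`. -/
def extDerivForm {k : ℕ} (η : ∀ x : M, TangentSpace (𝓡 (2 * n)) x [⋀^Fin k]→L[ℝ] ℂ) (x : M) :
    TangentSpace (𝓡 (2 * n)) x [⋀^Fin (k + 1)]→L[ℝ] ℂ :=
  ContinuousAlternatingMap.compContinuousLinearMap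
    (M := EuclideanSpace ℝ (Fin (2 * n)))
    (extDeriv (formInChart η x) (extChartAt (𝓡 (2 * n)) x x))
    (mfderiv (𝓡 (2 * n)) 𝓘(ℝ, EuclideanSpace ℝ (Fin (2 * n))) (extChartAt (𝓡 (2 * n)) x) x)

/-- The differential of a complex-valued function. -/
def differential (f : M → ℂ) (x : M) : TangentSpace (𝓡 (2 * n)) x →L[ℝ] ℂ :=
  mfderiv (𝓡 (2 * n)) 𝓘(ℝ, ℂ) f x

theorem contDiff_const_mul_complex (c : ℂ) : ContDiff ℝ ∞ fun z : ℂ => c * z :=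
  contDiff_const.mul contDiff_id

theorem differential_add {f g : M → ℂ} {x : M}
    (hf : MDifferentiableAt (𝓡 (2 * n)) 𝓘(ℝ, ℂ) f x)
    (hg : MDifferentiableAt (𝓡 (2 * n)) 𝓘(ℝ, ℂ) g x) :
    differential (n := n) (f + g) x = differential f x + differential g x :=
  (hf.hasMFDerivAt.add hg.hasMFDerivAt).mfderiv

theorem differential_smul (c : ℂ) {f : M → ℂ} {x : M}
    (hf : MDifferentiableAt (𝓡 (2 * n)) 𝓘(ℝ, ℂ) f x)
    (v : TangentSpace (𝓡 (2 * n)) x) :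
    differential (n := n) (c • f) x v = c * differential f x v := by
  have h1 : HasMFDerivAt 𝓘(ℝ, ℂ) 𝓘(ℝ, ℂ) (fun z : ℂ => c * z) (f x)
      (c • ContinuousLinearMap.id ℝ ℂ) :=
    ((hasFDerivAt_id (𝕜 := ℝ) (f x)).const_mul c).hasMFDerivAt
  have h2 := (h1.comp x hf.hasMFDerivAt).mfderiv
  have h3 : differential (n := n) (c • f) x
      = (c • ContinuousLinearMap.id ℝ ℂ).comp (differential (n := n) f x) := h2
  rw [h3]
  rfl

variable [IsManifold (𝓡 (2 * n)) ∞ M]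

/-- `∂̄f`, the `(0,1)`-part of `df`: `∂̄f(v) = df(v^{0,1}) = (df(v) + i df(Jv)) / 2`. -/
def delbarFun (J : AlmostComplexStructure n M) (f : M → ℂ) (x : M)
    (v : TangentSpace (𝓡 (2 * n)) x) : ℂ :=
  (1 / 2 : ℂ) * (differential f x v + Complex.I * differential f x (J.toFun x v))

/-- The fibre at `x` of the canonical bundle `ω_X = Λ^{n,0}`. -/
abbrev CanonicalFiber (J : AlmostComplexStructure n M) (x : M) : Type :=
  typeZero (J.toFun x) n

/-- The operator `∂̄` from sections of `ω_X = Λ^{n,0}` to sections of `Λ^{0,1} ⊗ ω_X`. The form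
`∂̄σ` is the `(n,1)`-component of `dσ`; under the identification `θ ∧ τ ↔ θ ⊗ τ` of `Λ^{n,1}` with
`Λ^{0,1} ⊗ Λ^{n,0}` it sends a tangent vector `v` to the `(n,0)`-form
`(w₁, …, w_n) ↦ dσ(v^{0,1}, w₁^{1,0}, …, w_n^{1,0})`. -/
def delbarCanonical (J : AlmostComplexStructure n M) (σ : ∀ x : M, CanonicalFiber J x) (x : M)
    (v : TangentSpace (𝓡 (2 * n)) x) : CanonicalFiber J x :=
  ⟨holoPart (J.toFun x)
    (interiorZeroOne (J.toFun x) (extDerivForm (fun y => (σ y).1) x) v),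
    holoPart_mem_typeZero (J.sq x) _⟩

/-- A smooth local frame of the line bundle `ω_X` over `U`
(the values of `σ` outside `U` are irrelevant). -/
def IsCanonicalFrameOn (J : AlmostComplexStructure n M) (σ : ∀ x : M, CanonicalFiber J x)
    (U : Set M) : Prop :=
  IsSmoothFormOn (fun x => (σ x).1) U ∧ ∀ x ∈ U, σ x ≠ 0

/-- The fibre at `x` of `ω_X^{⊗m}`. -/
abbrev PluriFiber (J : AlmostComplexStructure n M) (m : ℕ) (x : M) : Type :=
  ⨂[ℂ]^m (CanonicalFiber J x)

/-- The section `σ^{⊗m}` of `ω_X^{⊗m}`. -/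
def tensorPow (J : AlmostComplexStructure n M) (m : ℕ) (σ : ∀ x : M, CanonicalFiber J x)
    (x : M) : PluriFiber J m x :=
  PiTensorProduct.tprod ℂ fun _ : Fin m => σ x

/-- The Leibniz rule `∂̄(σ^{⊗m}) = ∑ᵢ σ ⊗ … ⊗ ∂̄σ ⊗ … ⊗ σ` (with `∂̄σ` in the `i`-th place),
evaluated on a tangent vector. -/
def delbarTensorPow (J : AlmostComplexStructure n M) (m : ℕ) (σ : ∀ x : M, CanonicalFiber J x)
    (x : M) (v : TangentSpace (𝓡 (2 * n)) x) : PluriFiber J m x :=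
  ∑ i : Fin m, PiTensorProduct.tprod ℂ
    (update (fun _ : Fin m => σ x) i (delbarCanonical J σ x v))

/-- `s` is a smooth section of `ω_X^{⊗m}` and `∂̄s = D`, where `D` is a section of
`Λ^{0,1} ⊗ ω_X^{⊗m}`, written as a function of a tangent vector: in every smooth local frame `σ`
of `ω_X`, the section is `s = f σ^{⊗m}` with `f` smooth, and
`D = ∂̄f ⊗ σ^{⊗m} + f ∂̄(σ^{⊗m})`. -/
def HasDelbar (J : AlmostComplexStructure n M) (m : ℕ) (s : ∀ x : M, PluriFiber J m x)
    (D : ∀ x : M, TangentSpace (𝓡 (2 * n)) x → PluriFiber J m x) : Prop :=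
  ∀ (U : Set M) (σ : ∀ x : M, CanonicalFiber J x), IsOpen U → IsCanonicalFrameOn J σ U →
    ∃ f : M → ℂ, ContMDiffOn (𝓡 (2 * n)) 𝓘(ℝ, ℂ) ∞ f U ∧
      (∀ x ∈ U, s x = f x • tensorPow J m σ x) ∧
      ∀ x ∈ U, ∀ v : TangentSpace (𝓡 (2 * n)) x,
        D x v = delbarFun J f x v • tensorPow J m σ x + f x • delbarTensorPow J m σ x v

theorem delbarFun_add (J : AlmostComplexStructure n M) {f g : M → ℂ} {x : M}
    (hf : MDifferentiableAt (𝓡 (2 * n)) 𝓘(ℝ, ℂ) f x)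
    (hg : MDifferentiableAt (𝓡 (2 * n)) 𝓘(ℝ, ℂ) g x) (v : TangentSpace (𝓡 (2 * n)) x) :
    delbarFun J (f + g) x v = delbarFun J f x v + delbarFun J g x v := by
  simp only [delbarFun, differential_add hf hg, add_apply]
  ring

theorem delbarFun_smul (J : AlmostComplexStructure n M) (c : ℂ) {f : M → ℂ} {x : M}
    (hf : MDifferentiableAt (𝓡 (2 * n)) 𝓘(ℝ, ℂ) f x) (v : TangentSpace (𝓡 (2 * n)) x) :
    delbarFun J (c • f) x v = c * delbarFun J f x v := by
  simp only [delbarFun, differential_smul c hf]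
  ring

theorem delbarFun_zero (J : AlmostComplexStructure n M) (x : M)
    (v : TangentSpace (𝓡 (2 * n)) x) : delbarFun J (0 : M → ℂ) x v = 0 := by
  have h : delbarFun J ((0 : ℂ) • (0 : M → ℂ)) x v = 0 := by
    rw [delbarFun_smul J 0 (f := 0) mdifferentiableAt_const, zero_mul]
  simpa using h

/-- `H⁰(X, O_X)`: the smooth functions `f : M → ℂ` with `∂̄f = 0`. -/
def holoFunctions (J : AlmostComplexStructure n M) : Submodule ℂ (M → ℂ) where
  carrier := {f | ContMDiff (𝓡 (2 * n)) 𝓘(ℝ, ℂ) ∞ f ∧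
    ∀ (x : M) (v : TangentSpace (𝓡 (2 * n)) x), delbarFun J f x v = 0}
  add_mem' := by
    rintro f g ⟨hf, hf'⟩ ⟨hg, hg'⟩
    refine ⟨hf.add hg, fun x v => ?_⟩
    rw [delbarFun_add J (hf.mdifferentiable (by simp) x) (hg.mdifferentiable (by simp) x), hf', hg',
      add_zero]
  zero_mem' := ⟨contMDiff_const, fun x v => delbarFun_zero J x v⟩
  smul_mem' := by
    rintro c f ⟨hf, hf'⟩
    refine ⟨(contDiff_const_mul_complex c).contMDiff.comp hf, fun x v => ?_⟩
    rw [delbarFun_smul J c (hf.mdifferentiable (by simp) x), hf', mul_zero]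

/-- `H⁰(X, ω_X^{⊗m})`: the smooth sections `s` of `ω_X^{⊗m}` with `∂̄s = 0`. -/
def pluriSections (J : AlmostComplexStructure n M) (m : ℕ) :
    Submodule ℂ (∀ x : M, PluriFiber J m x) where
  carrier := {s | HasDelbar J m s fun _ _ => 0}
  add_mem' := by
    intro s t hs ht U σ hU hσ
    obtain ⟨f, hf, hsf, hf'⟩ := hs U σ hU hσ
    obtain ⟨g, hg, htg, hg'⟩ := ht U σ hU hσ
    refine ⟨f + g, hf.add hg, fun x hx => ?_, fun x hx v => ?_⟩
    · rw [Pi.add_apply, hsf x hx, htg x hx, Pi.add_apply, add_smul]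
    · have h1 := (hf.contMDiffAt (hU.mem_nhds hx)).mdifferentiableAt (by simp)
      have h2 := (hg.contMDiffAt (hU.mem_nhds hx)).mdifferentiableAt (by simp)
      rw [delbarFun_add J h1 h2, Pi.add_apply, add_smul, add_smul, add_add_add_comm,
        ← hf' x hx v, ← hg' x hx v, add_zero]
  zero_mem' := by
    intro U σ hU hσ
    refine ⟨0, contMDiffOn_const, fun x _ => by simp, fun x _ v => ?_⟩
    rw [delbarFun_zero]
    simp
  smul_mem' := by
    intro c s hs U σ hU hσ
    obtain ⟨f, hf, hsf, hf'⟩ := hs U σ hU hσ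
    refine ⟨c • f, (contDiff_const_mul_complex c).contMDiff.comp_contMDiffOn hf, fun x hx => ?_, fun x hx v => ?_⟩
    · rw [Pi.smul_apply, hsf x hx, Pi.smul_apply, smul_assoc]
    · have h1 := (hf.contMDiffAt (hU.mem_nhds hx)).mdifferentiableAt (by simp)
      rw [delbarFun_smul J c h1, Pi.smul_apply, smul_assoc, mul_smul, ← smul_add,
        ← hf' x hx v, smul_zero]

/-- The `m`-th plurigenus `P_m(X) = dim H⁰(X, ω_X^{⊗m})`. -/
def plurigenus (J : AlmostComplexStructure n M) (m : ℕ) : ℕ∞ :=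
  Cardinal.toENat (Module.rank ℂ (pluriSections J m))

open Classical in
/-- The Kodaira dimension: `-∞` if `H⁰(X, ω_X^{⊗m}) = 0` for all `m ≥ 1`, and otherwise
`limsup_{m → ∞} log P_m(X) / log m`, with `log 0 = -∞`. -/
def kodairaDim (J : AlmostComplexStructure n M) : EReal :=
  if ∀ m : ℕ, 1 ≤ m → pluriSections J m = ⊥ then ⊥
  else limsup (fun m : ℕ => ENNReal.log (plurigenus J m) / ENNReal.log m) atTop

/-- A parallelism `v₁, w₁, …, v_n, w_n` of `M` (smooth vector fields forming a basis of every
tangent space) in which `J` is in standard form: `J v_i = w_i` and `J w_i = -v_i`. -/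
structure StandardParallelism (J : AlmostComplexStructure n M) where
  v : Fin n → ∀ x : M, TangentSpace (𝓡 (2 * n)) x
  w : Fin n → ∀ x : M, TangentSpace (𝓡 (2 * n)) x
  isFrame : IsLocalFrameOn (𝓡 (2 * n)) (EuclideanSpace ℝ (Fin (2 * n))) ∞
    (V := fun x : M => TangentSpace (𝓡 (2 * n)) x) (Sum.elim v w) univ
  J_v : ∀ (i : Fin n) (x : M), J.toFun x (v i x) = w i x
  J_w : ∀ (i : Fin n) (x : M), J.toFun x (w i x) = -v i x

namespace StandardParallelism

variable {J : AlmostComplexStructure n M} (P : StandardParallelism J)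

/-- The basis `v₁(x), …, v_n(x), w₁(x), …, w_n(x)` of the tangent space at `x`. -/
def basis (x : M) : Module.Basis (Fin n ⊕ Fin n) ℝ (TangentSpace (𝓡 (2 * n)) x) :=
  P.isFrame.toBasisAt (mem_univ x)

/-- The `(1,0)`-form `φⁱ = vⁱ + i wⁱ`, where `v¹, w¹, …, vⁿ, wⁿ` is the dual coframe. -/
def phi (i : Fin n) (x : M) : TangentSpace (𝓡 (2 * n)) x →L[ℝ] ℂ :=
  haveI : FiniteDimensional ℝ (TangentSpace (𝓡 (2 * n)) x) := (P.basis x).finiteDimensional_of_finite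
  haveI : T2Space (TangentSpace (𝓡 (2 * n)) x) :=
    inferInstanceAs (T2Space (EuclideanSpace ℝ (Fin (2 * n))))
  LinearMap.toContinuousLinearMap
    (((P.basis x).coord (Sum.inl i)).smulRight (1 : ℂ)
      + ((P.basis x).coord (Sum.inr i)).smulRight Complex.I)

theorem phi_apply (i : Fin n) (x : M) (u : TangentSpace (𝓡 (2 * n)) x) :
    P.phi i x u = ((P.basis x).coord (Sum.inl i) u : ℂ)
      + ((P.basis x).coord (Sum.inr i) u : ℂ) * Complex.I := by
  change ((P.basis x).coord (Sum.inl i) u) • (1 : ℂ)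
    + ((P.basis x).coord (Sum.inr i) u) • Complex.I = _
  simp

theorem basis_inl (i : Fin n) (x : M) : P.basis x (Sum.inl i) = P.v i x := by
  simp [basis]

theorem basis_inr (i : Fin n) (x : M) : P.basis x (Sum.inr i) = P.w i x := by
  simp [basis]

theorem phi_J (i : Fin n) (x : M) (u : TangentSpace (𝓡 (2 * n)) x) :
    P.phi i x (J.toFun x u) = Complex.I * P.phi i x u := by
  have h : (P.phi i x).toLinearMap ∘ₗ (J.toFun x).toLinearMap
      = (LinearMap.mulLeft ℝ Complex.I) ∘ₗ (P.phi i x).toLinearMap := by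
    refine (P.basis x).ext fun j => ?_
    rcases j with j | j
    · have h1 : J.toFun x (P.basis x (Sum.inl j)) = P.basis x (Sum.inr j) := by
        rw [basis_inl, basis_inr, P.J_v]
      simp only [LinearMap.comp_apply, ContinuousLinearMap.coe_coe, h1, phi_apply,
        LinearMap.mulLeft_apply, Module.Basis.coord_apply, Module.Basis.repr_self]
      by_cases hij : j = i
      · subst hij; simp
      · simp [hij]
    · have h1 : J.toFun x (P.basis x (Sum.inr j)) = -P.basis x (Sum.inl j) := by
        rw [basis_inl, basis_inr, P.J_w]
      simp only [LinearMap.comp_apply, ContinuousLinearMap.coe_coe, h1, phi_apply, map_neg,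
        LinearMap.mulLeft_apply, Module.Basis.coord_apply, Module.Basis.repr_self]
      by_cases hij : j = i
      · subst hij; simp
      · simp [hij]
  exact congrArg (fun L => L u) h

/-- The canonical section `ψ = φ¹ ∧ … ∧ φⁿ` of `ω_X`. -/
def psi (x : M) : CanonicalFiber J x :=
  ⟨wedge fun i => P.phi i x, wedge_mem_typeZero fun i u => P.phi_J i x u⟩

end StandardParallelism

end Manifold

end AlmostComplex

end

/-! The form ψ vanishes nowhere, so ψ^{⊗m} trivialises ω_X^{⊗m} and every smooth section is f ψ^{⊗m}
for a smooth function f. Since ∂̄ψ = 0, the Leibniz rule reduces ∂̄(f ψ^{⊗m}) to ∂̄f ⊗ ψ^{⊗m}, so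
the section is ∂̄-closed exactly when f is (`exists_eq_smul_tensorPow`, `smul_tensorPow_mem`). This
gives the isomorphism. It remains to see that on a compact connected M every ∂̄-closed function is
constant.

Since J need not be integrable, there may be no holomorphic coordinates, and a second-order equation
replaces them. The condition ∂̄f = 0 says Df ∘ J = i Df. Differentiating it in a chart and using the
symmetry of D²f gives, for each constant field X, D²f(X, X) + D²f(JX, JX) = Df(b) with b real and
continuous (`second_order_of_delbar`), so Re f satisfies the same equation. Each such operator is
only degenerate elliptic, but X is free: Hopf's barrier argument needs strict positivity only in the
radial direction at a touching point, and X is taken to be that direction (`hopf_barrier`,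
`eventually_eq_of_isMax`).

Hence the set where Re f is maximal is open as well as closed, and Re f is constant; the same
argument for -if handles Im f (`exists_eq_const`). All the spaces of sections are therefore
one-dimensional, and log P_m / log m is identically 0. -/

namespace AlmostComplex

/-! ### Strong maximum principle for degenerate second-order equations -/

section MaximumPrinciple

open scoped RealInnerProductSpace

theorem fderiv_fderiv_nonpos_of_isLocalMax {E : Type*} [NormedAddCommGroup E] [NormedSpace ℝ E]
    {w : E → ℝ} {y : E} (hw : ContDiffAt ℝ 2 w y) (hmax : IsLocalMax w y) (X : E) :
    fderiv ℝ (fderiv ℝ w) y X X ≤ 0 := by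
  by_contra! hpos
  have hline : ∀ t : ℝ, HasDerivAt (fun t : ℝ => y + t • X) X t := fun t => by
    simpa using ((hasDerivAt_id t).smul_const X).const_add y
  have hcont : ContinuousAt (fun t : ℝ => y + t • X) 0 := (hline 0).continuousAt
  have hy0 : y + (0 : ℝ) • X = y := by simp
  have htend : Tendsto (fun t : ℝ => y + t • X) (𝓝 0) (𝓝 y) := by
    simpa [ContinuousAt] using hcont
  have hd : ∀ᶠ z in 𝓝 y, DifferentiableAt ℝ w z :=
    (hw.eventually (by simp)).mono fun z hz => hz.differentiableAt (by simp)
  have hd1 : deriv (fun t : ℝ => w (y + t • X)) =ᶠ[𝓝 0]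
      fun t => fderiv ℝ w (y + t • X) X := by
    filter_upwards [htend.eventually hd] with t ht
    exact (ht.hasFDerivAt.comp_hasDerivAt t (hline t)).deriv
  have hd2 : deriv (deriv (fun t : ℝ => w (y + t • X))) 0 = fderiv ℝ (fderiv ℝ w) y X X := by
    rw [hd1.deriv_eq]
    have h1 : HasFDerivAt (fderiv ℝ w) (fderiv ℝ (fderiv ℝ w) y) (y + (0 : ℝ) • X) := by
      rw [hy0]
      exact ((hw.fderiv_right (m := 1) (by norm_num)).differentiableAt (by simp)).hasFDerivAt
    have h2 := h1.comp_hasDerivAt (0 : ℝ) (hline 0)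
    have h3 := h2.clm_apply (hasDerivAt_const (0 : ℝ) X)
    simpa using h3.deriv
  have hmax0 : IsLocalMax (fun t : ℝ => w (y + t • X)) 0 := by
    have := htend.eventually hmax
    simpa [IsLocalMax, IsMaxFilter] using this
  -- A positive second derivative would make the maximum along the line a local minimum too. The
  -- function is then locally constant on the line, so its second derivative is 0 after all.
  have hmin0 : IsLocalMin (fun t : ℝ => w (y + t • X)) 0 := by
    refine isLocalMin_of_deriv_deriv_pos (hd2 ▸ hpos) hmax0.deriv_eq_zero ?_
    exact ContinuousAt.comp (by rw [hy0]; exact hw.continuousAt) hcont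
  have hconst : (fun t : ℝ => w (y + t • X)) =ᶠ[𝓝 0] fun _ => w y := by
    filter_upwards [hmax0, hmin0] with t h1 h2
    simp only [hy0] at h1 h2
    exact le_antisymm h1 h2
  have h0 : deriv (deriv (fun t : ℝ => w (y + t • X))) 0 = 0 := by
    rw [hconst.deriv.deriv_eq]
    simp
  rw [hd2] at h0
  exact hpos.ne' h0

variable {E : Type*} [NormedAddCommGroup E] [InnerProductSpace ℝ E]

theorem hasFDerivAt_gaussian (a : ℝ) (q y : E) :
    HasFDerivAt (fun y : E => Real.exp (-a * ‖y - q‖ ^ 2))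
      ((-2 * a * Real.exp (-a * ‖y - q‖ ^ 2)) • innerSL ℝ (y - q)) y := by
  have h1 := ((((hasFDerivAt_id (𝕜 := ℝ) y).sub_const q).norm_sq).const_mul (-a)).exp
  refine h1.congr_fderiv ?_
  ext X
  simp
  ring

theorem fderiv_fderiv_gaussian (a : ℝ) (q y X : E) :
    fderiv ℝ (fderiv ℝ (fun y : E => Real.exp (-a * ‖y - q‖ ^ 2))) y X X =
      Real.exp (-a * ‖y - q‖ ^ 2) * (4 * a ^ 2 * ⟪y - q, X⟫ ^ 2 - 2 * a * ‖X‖ ^ 2) := by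
  have h0 : fderiv ℝ (fun y : E => Real.exp (-a * ‖y - q‖ ^ 2)) =
      fun y => (-2 * a * Real.exp (-a * ‖y - q‖ ^ 2)) • innerSL ℝ (y - q) :=
    funext fun y => (hasFDerivAt_gaussian a q y).fderiv
  have h1 : HasFDerivAt (fun y : E => innerSL ℝ (y - q)) (innerSL ℝ : E →L[ℝ] E →L[ℝ] ℝ) y :=
    (innerSL ℝ : E →L[ℝ] E →L[ℝ] ℝ).hasFDerivAt.comp y ((hasFDerivAt_id y).sub_const q)
  have h2 := ((hasFDerivAt_gaussian a q y).const_mul (-2 * a)).smul h1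
  have h3 := h2.fderiv
  rw [h0]
  change fderiv ℝ ((fun y : E => -2 * a * Real.exp (-a * ‖y - q‖ ^ 2)) •
    fun y : E => innerSL ℝ (y - q)) y X X = _
  rw [h3]
  have h4 : innerSL ℝ X X = ‖X‖ ^ 2 := real_inner_self_eq_norm_sq X
  simp [h4, inner_sub_left]
  ring

/-- A function attaining the value `m` at exactly one point `p` of a closed ball, on the boundary
of that ball, and nowhere exceeding `m`, cannot satisfy the (degenerate) elliptic equation
`D²u(X, X) + D²u(JX, JX) = Du(b)` near `p`, where `X = p - q` is the radial direction. -/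
theorem hopf_barrier [FiniteDimensional ℝ E] {Ω : Set E} (hΩ : IsOpen Ω) {u : E → ℝ}
    (hu : ContDiffOn ℝ 2 u Ω) {m : ℝ} (hle : ∀ y ∈ Ω, u y ≤ m) {p q : E} (hp : p ∈ Ω)
    (hpq : p ≠ q) (hup : u p = m)
    (hlt : ∀ y ∈ Ω, dist y q ≤ dist p q → y ≠ p → u y < m)
    {Y b : E → E} (hY : ContinuousOn Y Ω) (hb : ContinuousOn b Ω)
    (heq : ∀ y ∈ Ω, fderiv ℝ (fderiv ℝ u) y (p - q) (p - q) + fderiv ℝ (fderiv ℝ u) y (Y y) (Y y)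
      = fderiv ℝ u y (b y)) : False := by
  set X := p - q with hX
  have hX0 : 0 < ‖X‖ ^ 2 := by have : X ≠ 0 := sub_ne_zero.2 hpq; positivity
  -- With h the Gaussian exp(-a‖y - q‖²), the quantity D²h(X, X) + D²h(Y, Y) - Dh(b) equals 2a h
  -- (2a⟪y - q, X⟫² + 2a⟪y - q, Y⟫² - g). The function g collects everything that a large a has to
  -- beat.
  set g : E → ℝ := fun y => ‖X‖ ^ 2 + ‖Y y‖ ^ 2 - ⟪y - q, b y⟫ with hg
  have hgc : ContinuousAt g p := by
    have h1 : ContinuousAt Y p := hY.continuousAt (hΩ.mem_nhds hp)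
    have h2 : ContinuousAt b p := hb.continuousAt (hΩ.mem_nhds hp)
    exact (continuousAt_const.add (h1.norm.pow 2)).sub
      ((continuousAt_id.sub continuousAt_const).inner h2)
  have hic : ContinuousAt (fun y : E => ⟪y - q, X⟫) p :=
    (continuousAt_id.sub continuousAt_const).inner continuousAt_const
  set C : ℝ := |g p| + 1 with hC
  have hC0 : 0 < C := by positivity
  have hev : ∀ᶠ y in 𝓝 p, y ∈ Ω ∧ g y < C ∧ ‖X‖ ^ 2 / 2 < ⟪y - q, X⟫ := by
    have hΩp : ∀ᶠ y in 𝓝 p, y ∈ Ω := hΩ.mem_nhds hp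
    refine hΩp.and ((hgc.eventually_lt continuousAt_const ?_).and
      (continuousAt_const.eventually_lt hic ?_))
    · exact (le_abs_self _).trans_lt (lt_add_one _)
    · rw [← hX, real_inner_self_eq_norm_sq]; linarith
  obtain ⟨ρ, hρ, hball⟩ := Metric.nhds_basis_closedBall.eventually_iff.1 hev
  -- Near p one has ⟪y - q, X⟫ > ‖X‖²/2 because X = p - q. This choice of a therefore gives a⟪y - q,
  -- X⟫² > C > g, whatever the direction of Y, whose own term is nonnegative.
  set a : ℝ := C / (‖X‖ ^ 2 / 2) ^ 2 with ha
  have ha0 : 0 < a := by positivity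
  set h : E → ℝ := fun y => Real.exp (-a * ‖y - q‖ ^ 2) with hh
  set h₀ : ℝ := Real.exp (-a * ‖p - q‖ ^ 2) with hh0
  have hhcd : ContDiff ℝ 2 h := by
    exact ((contDiff_const.mul ((contDiff_id.sub contDiff_const).norm_sq ℝ))).exp
  have hLh : ∀ y ∈ Metric.closedBall p ρ,
      fderiv ℝ h y (b y) < fderiv ℝ (fderiv ℝ h) y X X + fderiv ℝ (fderiv ℝ h) y (Y y) (Y y) := by
    intro y hy
    obtain ⟨-, h1, h2⟩ := hball hy
    rw [(hasFDerivAt_gaussian a q y).fderiv, fderiv_fderiv_gaussian, fderiv_fderiv_gaussian]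
    simp only [smul_apply, innerSL_apply_apply, smul_eq_mul]
    have e0 : 0 < Real.exp (-a * ‖y - q‖ ^ 2) := Real.exp_pos _
    have h3 : (‖X‖ ^ 2 / 2) ^ 2 < ⟪y - q, X⟫ ^ 2 := by gcongr
    have h4 : a * (‖X‖ ^ 2 / 2) ^ 2 = C := div_mul_cancel₀ C (by positivity)
    have h5 : C < a * ⟪y - q, X⟫ ^ 2 := by rw [← h4]; gcongr
    have h6 : 0 ≤ a * ⟪y - q, Y y⟫ ^ 2 := by positivity
    have h7 : ‖X‖ ^ 2 + ‖Y y‖ ^ 2 - ⟪y - q, b y⟫ < C := h1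
    have h8 : 0 < Real.exp (-a * ‖y - q‖ ^ 2) * (2 * a) *
        (2 * (a * ⟪y - q, X⟫ ^ 2) + 2 * (a * ⟪y - q, Y y⟫ ^ 2)
          - (‖X‖ ^ 2 + ‖Y y‖ ^ 2 - ⟪y - q, b y⟫)) := by
      apply mul_pos (by positivity)
      linarith
    linarith
  have hcompact : IsCompact (Metric.sphere p ρ ∩ Metric.closedBall q (dist p q)) :=
    (isCompact_sphere p ρ).inter_right Metric.isClosed_closedBall
  have hsub : Metric.closedBall p ρ ⊆ Ω := fun y hy => (hball hy).1
  -- The part of the small sphere inside the large ball is compact and avoids p, so u stays below m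
  -- there by a uniform gap.
  obtain ⟨δ, hδ, hδu⟩ : ∃ δ > 0, ∀ y ∈ Metric.sphere p ρ ∩ Metric.closedBall q (dist p q),
      u y + δ ≤ m := by
    rcases (Metric.sphere p ρ ∩ Metric.closedBall q (dist p q)).eq_empty_or_nonempty with h | h
    · exact ⟨1, one_pos, by simp [h]⟩
    · obtain ⟨z, hz, hzmax⟩ := hcompact.exists_isMaxOn h
        (hu.continuousOn.mono fun y hy => hsub (Metric.sphere_subset_closedBall hy.1))
      refine ⟨m - u z, sub_pos.2 (hlt z (hsub (Metric.sphere_subset_closedBall hz.1)) hz.2 ?_),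
        fun y hy => ?_⟩
      · rintro rfl
        have := hz.1
        simp at this
        exact hρ.ne this
      · have := hzmax hy
        simp only [mem_ofPred_eq] at this
        linarith
  set ε : ℝ := δ / 2 with hε
  have hε0 : 0 < ε := by positivity
  set w : E → ℝ := fun y => u y + ε * h y with hw
  have hwc : ContinuousOn w (Metric.closedBall p ρ) :=
    (hu.continuousOn.mono hsub).add (continuous_const.mul hhcd.continuous).continuousOn
  obtain ⟨y, hy, hymax⟩ := (isCompact_closedBall p ρ).exists_isMaxOn
    ⟨p, Metric.mem_closedBall_self hρ.le⟩ hwc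
  have hwp : m + ε * h₀ ≤ w y := by
    have := hymax (Metric.mem_closedBall_self hρ.le)
    simpa [hw, hup] using this
  -- On the small sphere w stays below w(p) = m + ε h₀. Inside the large ball the gap δ outweighs ε
  -- h ≤ δ/2; outside it u ≤ m and h < h₀.
  have hyint : y ∈ Metric.ball p ρ := by
    by_contra hny
    have hys : y ∈ Metric.sphere p ρ := by
      rw [Metric.mem_sphere]
      exact le_antisymm hy (not_lt.1 hny)
    by_cases hyq : dist y q ≤ dist p q
    · have h1 := hδu y ⟨hys, hyq⟩
      have h2 : h y ≤ 1 := Real.exp_le_one_iff.2 (by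
        have : 0 ≤ a * ‖y - q‖ ^ 2 := by positivity
        linarith)
      have h3 : 0 < h₀ := Real.exp_pos _
      have h4 : ε * h y ≤ ε * 1 := by gcongr
      have h5 : 0 < ε * h₀ := by positivity
      have : w y = u y + ε * h y := rfl
      linarith
    · have h1 := hle y (hsub hy)
      have h2 : h y < h₀ := by
        refine Real.exp_lt_exp.2 ?_
        rw [not_le, dist_eq_norm, dist_eq_norm] at hyq
        have : ‖p - q‖ ^ 2 < ‖y - q‖ ^ 2 := by gcongr
        have := mul_lt_mul_of_pos_left this ha0
        linarith
      have h3 : ε * h y < ε * h₀ := by gcongr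
      have : w y = u y + ε * h y := rfl
      linarith
  have hlm : IsLocalMax w y :=
    hymax.isLocalMax (Filter.mem_of_superset (Metric.isOpen_ball.mem_nhds hyint)
      Metric.ball_subset_closedBall)
  have hyΩ : y ∈ Ω := hsub hy
  have hua : ContDiffAt ℝ 2 u y := hu.contDiffAt (hΩ.mem_nhds hyΩ)
  have hha : ContDiffAt ℝ 2 h y := hhcd.contDiffAt
  have hwa : ContDiffAt ℝ 2 w y := hua.add (contDiffAt_const.mul hha)
  have hD1 : fderiv ℝ w =ᶠ[𝓝 y] fun z => fderiv ℝ u z + ε • fderiv ℝ h z := by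
    filter_upwards [hΩ.mem_nhds hyΩ] with z hz
    have h1 : DifferentiableAt ℝ u z :=
      (hu.contDiffAt (hΩ.mem_nhds hz)).differentiableAt (by simp)
    have h2 : DifferentiableAt ℝ h z := hhcd.contDiffAt.differentiableAt (by simp)
    exact (h1.hasFDerivAt.add (h2.hasFDerivAt.const_mul ε)).fderiv
  have hD2 : fderiv ℝ (fderiv ℝ w) y
      = fderiv ℝ (fderiv ℝ u) y + ε • fderiv ℝ (fderiv ℝ h) y := by
    rw [hD1.fderiv_eq]
    have h1 : DifferentiableAt ℝ (fderiv ℝ u) y :=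
      (hua.fderiv_right (m := 1) (by norm_num)).differentiableAt (by simp)
    have h2 : DifferentiableAt ℝ (fderiv ℝ h) y :=
      (hha.fderiv_right (m := 1) (by norm_num)).differentiableAt (by simp)
    exact (h1.hasFDerivAt.add (h2.hasFDerivAt.const_smul ε)).fderiv
  have hz : fderiv ℝ u y + ε • fderiv ℝ h y = 0 := by
    exact hD1.self_of_nhds.symm.trans hlm.fderiv_eq_zero
  have hz' : fderiv ℝ u y (b y) + ε * fderiv ℝ h y (b y) = 0 := by
    simpa using congrArg (fun L => L (b y)) hz
  -- At the interior maximum Dw = 0 and D²w ≤ 0 along X and Y. The equation for u together with the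
  -- strict inequality for h gives D²w(X, X) + D²w(Y, Y) > Dw(b) = 0, a contradiction.
  have hX2 := fderiv_fderiv_nonpos_of_isLocalMax hwa hlm X
  have hY2 := fderiv_fderiv_nonpos_of_isLocalMax hwa hlm (Y y)
  rw [hD2] at hX2 hY2
  simp only [add_apply, smul_apply, smul_eq_mul] at hX2 hY2
  have h1 := heq y hyΩ
  have h2 := mul_lt_mul_of_pos_left (hLh y hy) hε0
  linarith

/-- Strong maximum principle: if for every direction `X` a function `u ≤ m` satisfies an equation
`D²u(X, X) + D²u(Y, Y) = Du(b)` with continuous vector fields `Y` and `b`, then the set where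
`u = m` is open. -/
theorem eventually_eq_of_isMax [FiniteDimensional ℝ E] {Ω : Set E} (hΩ : IsOpen Ω) {u : E → ℝ}
    (hu : ContDiffOn ℝ 2 u Ω) {m : ℝ} (hle : ∀ y ∈ Ω, u y ≤ m)
    (heq : ∀ X : E, ∃ Y b : E → E, ContinuousOn Y Ω ∧ ContinuousOn b Ω ∧ ∀ y ∈ Ω,
      fderiv ℝ (fderiv ℝ u) y X X + fderiv ℝ (fderiv ℝ u) y (Y y) (Y y) = fderiv ℝ u y (b y))
    {p : E} (hp : p ∈ Ω) (hup : u p = m) : ∀ᶠ y in 𝓝 p, u y = m := by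
  obtain ⟨R, hR, hRΩ⟩ := Metric.nhds_basis_closedBall.mem_iff.1 (hΩ.mem_nhds hp)
  -- Half the radius keeps the point c of {u = m} nearest to q inside the open ball of radius R: c
  -- is no farther from q than p is.
  filter_upwards [Metric.ball_mem_nhds p (half_pos hR)] with q hq
  by_contra hne
  have hqR : dist q p < R / 2 := hq
  set A : Set E := Metric.closedBall p R ∩ u ⁻¹' {m} with hA
  have hAc : IsCompact A :=
    (isCompact_closedBall p R).of_isClosed_subset
      ((hu.continuousOn.mono hRΩ).preimage_isClosed_of_isClosed Metric.isClosed_closedBall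
        isClosed_singleton) inter_subset_left
  have hpA : p ∈ A := ⟨Metric.mem_closedBall_self hR.le, hup⟩
  obtain ⟨c, hcA, hcmin⟩ := hAc.exists_isMinOn ⟨p, hpA⟩
    (continuous_id.dist continuous_const : Continuous fun y => dist y q).continuousOn
  have hcmin' : ∀ y ∈ A, dist c q ≤ dist y q := fun y hy => hcmin hy
  have hcp : dist c q < R / 2 := (hcmin' p hpA).trans_lt (by rwa [dist_comm])
  have hcq : c ≠ q := by
    rintro rfl
    exact hne hcA.2
  have hball : Metric.ball p R ⊆ Ω := Metric.ball_subset_closedBall.trans hRΩ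
  have hcb : c ∈ Metric.ball p R := by
    rw [Metric.mem_ball]
    linarith [dist_triangle c q p]
  -- The ball around q through c may touch {u = m} at several points. The ball of half the radius
  -- centred at the midpoint q' is internally tangent to it and meets {u = m} only at c.
  set q' : E := (2 : ℝ)⁻¹ • (c + q) with hq'
  have hcq' : c - q' = (2 : ℝ)⁻¹ • (c - q) := by rw [hq']; module
  have hq'q : q' - q = (2 : ℝ)⁻¹ • (c - q) := by rw [hq']; module
  obtain ⟨Y, b, hY, hb, hYb⟩ := heq (c - q')
  refine hopf_barrier (p := c) (q := q') Metric.isOpen_ball (hu.mono hball)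
    (fun y hy => hle y (hball hy)) hcb ?_ hcA.2 ?_ (hY.mono hball) (hb.mono hball)
    fun y hy => hYb y (hball hy)
  · rw [← sub_ne_zero, hcq']
    exact smul_ne_zero (by norm_num) (sub_ne_zero.2 hcq)
  · intro y hy hyq' hyc
    refine lt_of_le_of_ne (hle y (hball hy)) fun hym => hyc ?_
    have h1 : dist c q ≤ dist y q := hcmin' y ⟨Metric.ball_subset_closedBall hy, hym⟩
    rw [dist_eq_norm, dist_eq_norm] at h1 hyq'
    have h2 : y - q = (y - q') + (c - q') := by rw [hcq', ← hq'q]; abel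
    have h3 : c - q = (2 : ℝ) • (c - q') := by rw [hcq']; module
    have h4 : ‖c - q‖ = 2 * ‖c - q'‖ := by rw [h3, norm_smul]; simp
    -- The parallelogram law makes the internal tangency quantitative: ‖y - q‖ ≥ 2‖c - q'‖ and ‖y -
    -- q'‖ ≤ ‖c - q'‖ force y = c.
    have h5 : ‖y - q‖ ^ 2 ≤ 2 * ‖y - q'‖ ^ 2 + 2 * ‖c - q'‖ ^ 2 - ‖y - c‖ ^ 2 := by
      have := parallelogram_law_with_norm ℝ (y - q') (c - q')
      rw [← h2, show y - q' - (c - q') = y - c by abel] at this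
      nlinarith
    have h6 : (2 * ‖c - q'‖) ^ 2 ≤ ‖y - q‖ ^ 2 := by rw [← h4]; gcongr
    have h7 : ‖y - q'‖ ^ 2 ≤ ‖c - q'‖ ^ 2 := by gcongr
    have h8 : ‖y - c‖ ^ 2 ≤ 0 := by nlinarith
    have h9 : ‖y - c‖ = 0 := pow_eq_zero_iff (two_ne_zero) |>.1 (le_antisymm h8 (by positivity))
    exact sub_eq_zero.1 (norm_eq_zero.1 h9)

/-! ### The second-order equation behind ∂̄f = 0 -/

/-- A function with `Df ∘ J = i Df` satisfies a second-order equation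
`D²f(X, X) + D²f(JX, JX) = Df(b)` for every constant vector field `X`. -/
theorem second_order_of_delbar {E : Type*} [NormedAddCommGroup E] [NormedSpace ℝ E]
    {Ω : Set E} (hΩ : IsOpen Ω) {f : E → ℂ} (hf : ContDiffOn ℝ 2 f Ω) {J : E → E →L[ℝ] E}
    (hJ : ContDiffOn ℝ 1 J Ω) (hfJ : ∀ y ∈ Ω, ∀ X, fderiv ℝ f y (J y X) = Complex.I * fderiv ℝ f y X)
    {y : E} (hy : y ∈ Ω) (X : E) :
    fderiv ℝ (fderiv ℝ f) y X X + fderiv ℝ (fderiv ℝ f) y (J y X) (J y X)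
      = fderiv ℝ f y (-(J y (fderiv ℝ J y X X) + fderiv ℝ J y (J y X) X)) := by
  have hfa : ContDiffAt ℝ 2 f y := hf.contDiffAt (hΩ.mem_nhds hy)
  have hJa : HasFDerivAt J (fderiv ℝ J y) y :=
    ((hJ.contDiffAt (hΩ.mem_nhds hy)).differentiableAt (by simp)).hasFDerivAt
  have hf' : HasFDerivAt (fderiv ℝ f) (fderiv ℝ (fderiv ℝ f) y) y :=
    ((hfa.fderiv_right (m := 1) (by norm_num)).differentiableAt (by simp)).hasFDerivAt
  have hsymm := hfa.isSymmSndFDerivAt (by simp)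
  -- Differentiate Df(JX) = i Df(X) in the direction Z. The cases Z = X and Z = JX share the mixed
  -- term D²f(X, JX), which is eliminated; the remaining factor i is absorbed by i Df = Df ∘ J.
  have key : ∀ Z, fderiv ℝ (fderiv ℝ f) y Z (J y X) + fderiv ℝ f y (fderiv ℝ J y Z X)
      = Complex.I * fderiv ℝ (fderiv ℝ f) y Z X := by
    intro Z
    have hJX := hJa.clm_apply (hasFDerivAt_const X y)
    have h1 := hf'.clm_apply hJX
    have h2 := (hf'.clm_apply (hasFDerivAt_const X y)).const_mul Complex.I
    have h3 : (fun z => fderiv ℝ f z (J z X)) =ᶠ[𝓝 y] fun z => Complex.I * fderiv ℝ f z X := by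
      filter_upwards [hΩ.mem_nhds hy] with z hz using hfJ z hz X
    have h4 := congrArg (fun L => L Z) (h1.unique (h2.congr_of_eventuallyEq h3))
    simp at h4
    rw [← h4]
    ring
  have k1 := key X
  have k2 := key (J y X)
  rw [hsymm.eq (J y X) X] at k2
  rw [map_neg, map_add, hfJ y hy]
  linear_combination k2 + Complex.I * k1 + (fderiv ℝ (fderiv ℝ f) y X X) * Complex.I_mul_I

/-- The set where the real part of a function with `Df ∘ J = i Df` attains its maximum is open. -/
theorem eventually_re_eq_of_delbar [FiniteDimensional ℝ E]
    {Ω : Set E} (hΩ : IsOpen Ω) {f : E → ℂ} (hf : ContDiffOn ℝ 2 f Ω) {J : E → E →L[ℝ] E}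
    (hJ : ContDiffOn ℝ 1 J Ω) (hfJ : ∀ y ∈ Ω, ∀ X, fderiv ℝ f y (J y X) = Complex.I * fderiv ℝ f y X)
    {m : ℝ} (hle : ∀ y ∈ Ω, (f y).re ≤ m) {p : E} (hp : p ∈ Ω) (hfp : (f p).re = m) :
    ∀ᶠ y in 𝓝 p, (f y).re = m := by
  have hre : ContDiffOn ℝ 2 (fun y => (f y).re) Ω :=
    Complex.reCLM.contDiff.comp_contDiffOn hf
  refine eventually_eq_of_isMax hΩ hre hle (fun X => ⟨fun y => J y X,
    fun y => -(J y (fderiv ℝ J y X X) + fderiv ℝ J y (J y X) X), ?_, ?_, ?_⟩) hp hfp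
  · exact hJ.continuousOn.clm_apply continuousOn_const
  · have hJ' : ContinuousOn (fderiv ℝ J) Ω := hJ.continuousOn_fderiv_of_isOpen hΩ le_rfl
    exact ((hJ.continuousOn.clm_apply ((hJ'.clm_apply continuousOn_const).clm_apply
      continuousOn_const)).add ((hJ'.clm_apply (hJ.continuousOn.clm_apply
      continuousOn_const)).clm_apply continuousOn_const)).neg
  · intro y hy
    have hD : ∀ z ∈ Ω, fderiv ℝ (fun y => (f y).re) z = Complex.reCLM.comp (fderiv ℝ f z) := by
      intro z hz
      have h1 : DifferentiableAt ℝ f z := (hf.contDiffAt (hΩ.mem_nhds hz)).differentiableAt (by simp)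
      exact (Complex.reCLM.hasFDerivAt.comp z h1.hasFDerivAt).fderiv
    have hD2 : ∀ Z W, fderiv ℝ (fderiv ℝ (fun y => (f y).re)) y Z W
        = (fderiv ℝ (fderiv ℝ f) y Z W).re := by
      intro Z W
      have h1 : fderiv ℝ (fun y => (f y).re) =ᶠ[𝓝 y] fun z => Complex.reCLM.comp (fderiv ℝ f z) := by
        filter_upwards [hΩ.mem_nhds hy] with z hz using hD z hz
      have hf' : HasFDerivAt (fderiv ℝ f) (fderiv ℝ (fderiv ℝ f) y) y :=
        (((hf.contDiffAt (hΩ.mem_nhds hy)).fderiv_right (m := 1)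
          (by norm_num)).differentiableAt (by simp)).hasFDerivAt
      rw [h1.fderiv_eq, ((hasFDerivAt_const Complex.reCLM y).clm_comp hf').fderiv]
      simp
    rw [hD2, hD2, hD y hy, ← Complex.add_re, second_order_of_delbar hΩ hf hJ hfJ hy X]
    rfl

end MaximumPrinciple

end AlmostComplex

namespace AlmostComplex

/-! ### Algebra of forms of type (k,0) -/

section TypeZero

variable {V : Type*} [AddCommGroup V] [Module ℝ V] [TopologicalSpace V] {J : V →L[ℝ] V}

theorem applyOn_insert {k : ℕ} {T : Finset (Fin k)} {i : Fin k} (hi : i ∉ T) (w : Fin k → V) :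
    applyOn J (insert i T) w = update (applyOn J T w) i (J (applyOn J T w i)) := by
  ext1 j
  by_cases h : j = i
  · subst h; simp [applyOn, hi]
  · simp [applyOn, h]

theorem typeZero_apply_applyOn {k : ℕ} {η : V [⋀^Fin k]→L[ℝ] ℂ} (hη : η ∈ typeZero J k)
    (T : Finset (Fin k)) (w : Fin k → V) : η (applyOn J T w) = Complex.I ^ T.card * η w := by
  induction T using Finset.induction_on with
  | empty =>
    have h : applyOn J ∅ w = w := funext fun j => by simp [applyOn]
    simp [h]
  | insert i T hi ih =>
    rw [applyOn_insert hi, hη, ih, Finset.card_insert_of_notMem hi, pow_succ]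
    ring

/-- Each of the 2^k summands is (-i)^|T| i^|T| η = η, which the factor 2^{-k} averages. -/
theorem holoPart_eq_self {k : ℕ} {η : V [⋀^Fin k]→L[ℝ] ℂ} (hη : η ∈ typeZero J k) :
    holoPart J η = η := by
  ext w
  have h : ∀ T : Finset (Fin k), (-Complex.I) ^ T.card * η (applyOn J T w) = η w := fun T => by
    rw [typeZero_apply_applyOn hη, ← mul_assoc, ← mul_pow]
    simp
  rw [holoPart_apply, Finset.sum_congr rfl fun T _ => h T]
  simp

theorem holoPart_add {k : ℕ} (η θ : V [⋀^Fin k]→L[ℝ] ℂ) :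
    holoPart J (η + θ) = holoPart J η + holoPart J θ := by
  ext w
  simp only [holoPart_apply, ContinuousAlternatingMap.add_apply, mul_add, Finset.sum_add_distrib]

theorem holoPart_smul {k : ℕ} (c : ℂ) (η : V [⋀^Fin k]→L[ℝ] ℂ) :
    holoPart J (c • η) = c • holoPart J η := by
  ext w
  simp only [holoPart_apply, ContinuousAlternatingMap.smul_apply, smul_eq_mul, mul_left_comm _ c,
    Finset.mul_sum]

theorem interiorZeroOne_apply {k : ℕ} (η : V [⋀^Fin (k + 1)]→L[ℝ] ℂ) (v : V) (w : Fin k → V) :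
    interiorZeroOne J η v w =
      (1 / 2 : ℂ) * (η (Fin.cons v w) + Complex.I * η (Fin.cons (J v) w)) := rfl

theorem interiorZeroOne_add {k : ℕ} (η θ : V [⋀^Fin (k + 1)]→L[ℝ] ℂ) (v : V) :
    interiorZeroOne J (η + θ) v = interiorZeroOne J η v + interiorZeroOne J θ v := by
  ext w
  simp only [interiorZeroOne_apply, ContinuousAlternatingMap.add_apply]
  ring

theorem interiorZeroOne_smul {k : ℕ} (c : ℂ) (η : V [⋀^Fin (k + 1)]→L[ℝ] ℂ) (v : V) :
    interiorZeroOne J (c • η) v = c • interiorZeroOne J η v := by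
  ext w
  simp only [interiorZeroOne_apply, ContinuousAlternatingMap.smul_apply, smul_eq_mul]
  ring

/-- For `η` of type `(k,0)` and a one-form `α`, the interior product of `α ∧ η` with `v^{0,1}` is
`α(v^{0,1}) η`. -/
theorem interiorZeroOne_of_eq_sum {k : ℕ} {η : V [⋀^Fin k]→L[ℝ] ℂ} (hη : η ∈ typeZero J k)
    (α : V → ℂ) {R : V [⋀^Fin (k + 1)]→L[ℝ] ℂ}
    (hR : ∀ w, R w = ∑ i : Fin (k + 1), (-1) ^ (i : ℕ) * (α (w i) * η (i.removeNth w))) (v : V) :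
    interiorZeroOne J R v = ((1 / 2 : ℂ) * (α v + Complex.I * α (J v))) • η := by
  ext w
  rw [interiorZeroOne_apply, hR, hR, Fin.sum_univ_succ, Fin.sum_univ_succ]
  -- A form of type (k,0) vanishes on v^{0,1}, since η(v, …) + i η(Jv, …) = (1 + i²) η(v, …). Only
  -- the term in which α receives v^{0,1} survives.
  have hz : ∀ j : Fin k, η (j.succ.removeNth (Fin.cons v w : Fin (k + 1) → V))
      + Complex.I * η (j.succ.removeNth (Fin.cons (J v) w : Fin (k + 1) → V)) = 0 := by
    intro j
    obtain _ | k := k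
    · exact j.elim0
    have h1 : (j.succ.removeNth (Fin.cons (J v) w : Fin (k + 2) → V))
        = update (j.succ.removeNth (Fin.cons v w : Fin (k + 2) → V)) 0
          (J (j.succ.removeNth (Fin.cons v w : Fin (k + 2) → V) 0)) := by
      ext1 i
      refine Fin.cases ?_ (fun i => ?_) i
      · simp [Fin.removeNth]
      · simp [Fin.removeNth]
    rw [h1, hη, ← mul_assoc, Complex.I_mul_I]
    ring
  have hs : ∑ j : Fin k, (-1 : ℂ) ^ ((j.succ : Fin (k + 1)) : ℕ) *
        (α ((Fin.cons v w : Fin (k + 1) → V) j.succ)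
          * η (j.succ.removeNth (Fin.cons v w : Fin (k + 1) → V)))
      + Complex.I * ∑ j : Fin k, (-1 : ℂ) ^ ((j.succ : Fin (k + 1)) : ℕ) *
        (α ((Fin.cons (J v) w : Fin (k + 1) → V) j.succ)
          * η (j.succ.removeNth (Fin.cons (J v) w : Fin (k + 1) → V))) = 0 := by
    rw [Finset.mul_sum, ← Finset.sum_add_distrib]
    refine Finset.sum_eq_zero fun j _ => ?_
    simp only [Fin.cons_succ]
    linear_combination (-1 : ℂ) ^ ((j.succ : Fin (k + 1)) : ℕ) * α (w j) * hz j
  have h0 : ∀ u : V, (Fin.removeNth 0 (Fin.cons u w : Fin (k + 1) → V)) = w := fun u => by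
    ext1 i; simp [Fin.removeNth]
  simp only [h0, Fin.cons_zero, Fin.val_zero, pow_zero, one_mul,
    ContinuousAlternatingMap.smul_apply, smul_eq_mul]
  linear_combination (1 / 2 : ℂ) * hs

/-- A form of type `(k,0)` is determined by its values on a complex spanning family. -/
theorem typeZero_eq_zero {ι : Type*} {v : ι → V}
    (hv : Submodule.span ℝ (range v ∪ range (J ∘ v)) = ⊤) {k : ℕ} {η : V [⋀^Fin k]→L[ℝ] ℂ}
    (hη : η ∈ typeZero J k) (h : ∀ a : Fin k → ι, η (v ∘ a) = 0) : η = 0 := by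
  -- Induction on the set T of slots allowed to hold arbitrary vectors. The kernel in a newly freed
  -- slot contains each v a, hence also J (v a), hence the whole span.
  have key : ∀ (T : Finset (Fin k)) (w : Fin k → V), (∀ j ∉ T, w j ∈ range v) → η w = 0 := by
    intro T
    induction T using Finset.induction_on with
    | empty =>
      intro w hw
      choose a ha using fun j => hw j (by simp)
      rw [← h a]
      congr 1
      exact (funext ha).symm
    | insert i T hi ih =>
      intro w hw
      have hker : Submodule.span ℝ (range v ∪ range (J ∘ v)) ≤
          LinearMap.ker (η.toMultilinearMap.toLinearMap w i) := by
        have h0 : ∀ a, η (update w i (v a)) = 0 := fun a => ih _ fun j hj => by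
          by_cases hji : j = i
          · subst hji; simp
          · simpa [hji] using hw j (by simp [hji, hj])
        rw [Submodule.span_le]
        rintro _ (⟨a, rfl⟩ | ⟨a, rfl⟩)
        · exact h0 a
        · have := hη (update w i (v a)) i
          rw [h0 a, update_idem, update_self, mul_zero] at this
          exact this
      rw [hv] at hker
      have := hker (Submodule.mem_top (x := w i))
      simpa using this
  ext w
  exact key Finset.univ w (by simp)

/-- With exactly k complex generators the degree is maximal: a tuple of generators either repeats
one or permutes v, so the single value at v determines the form. -/
theorem typeZero_eq_smul {k : ℕ} {v : Fin k → V}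
    (hv : Submodule.span ℝ (range v ∪ range (J ∘ v)) = ⊤) {η θ : V [⋀^Fin k]→L[ℝ] ℂ}
    (hη : η ∈ typeZero J k) (hθ : θ ∈ typeZero J k) (h1 : θ v = 1) : η = η v • θ := by
  rw [← sub_eq_zero]
  refine typeZero_eq_zero hv (Submodule.sub_mem _ hη (Submodule.smul_mem _ _ hθ)) fun a => ?_
  set ζ := η - η v • θ with hζ
  have h0 : ζ v = 0 := by simp [hζ, h1]
  by_cases ha : Injective a
  · have hb : Bijective a := Finite.injective_iff_bijective.1 ha
    have := ζ.toAlternatingMap.map_perm v (Equiv.ofBijective a hb)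
    change ζ (v ∘ a) = _ at this
    rw [this]
    change _ • ζ v = 0
    rw [h0, smul_zero]
  · obtain ⟨i, j, hij, hne⟩ := not_injective_iff.1 ha
    exact ζ.map_eq_zero_of_eq _ (by simp [hij]) hne

end TypeZero

theorem extDeriv_smul_fun_apply {E : Type*} [NormedAddCommGroup E] [NormedSpace ℝ E] {k : ℕ}
    {g : E → ℂ} {τ : E → E [⋀^Fin k]→L[ℝ] ℂ} {y : E} (hg : DifferentiableAt ℝ g y)
    (hω : DifferentiableAt ℝ τ y) (w : Fin (k + 1) → E) :
    extDeriv (fun z => g z • τ z) y w = g y * extDeriv τ y w +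
      ∑ i : Fin (k + 1), (-1) ^ (i : ℕ) * (fderiv ℝ g y (w i) * τ y (i.removeNth w)) := by
  have h := (hg.hasFDerivAt.smul hω.hasFDerivAt).fderiv
  change fderiv ℝ (fun z => g z • τ z) y = _ at h
  rw [extDeriv, h, extDeriv, ContinuousAlternatingMap.alternatizeUncurryFin_apply,
    ContinuousAlternatingMap.alternatizeUncurryFin_apply, Finset.mul_sum, ← Finset.sum_add_distrib]
  refine Finset.sum_congr rfl fun i _ => ?_
  simp
  ring

end AlmostComplex

/-! ### Forms and vector fields in charts; the Leibniz rule for ∂̄ -/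

noncomputable section

namespace AlmostComplex

/-- A map into the alternating forms on a finite-dimensional space is smooth if its values on
constant arguments are. -/
theorem contDiffOn_continuousAlternatingMap_iff {D E : Type*} [NormedAddCommGroup D]
    [NormedSpace ℝ D] [NormedAddCommGroup E] [NormedSpace ℝ E] [FiniteDimensional ℝ E] {k : ℕ}
    {r : WithTop ℕ∞} {F : D → E [⋀^Fin k]→L[ℝ] ℂ} {s : Set D} :
    ContDiffOn ℝ r F s ↔ ∀ w, ContDiffOn ℝ r (fun y => F y w) s := by
  let b := Module.finBasis ℝ E
  let ev : (E [⋀^Fin k]→L[ℝ] ℂ) →ₗ[ℝ] ((Fin k → Fin (Module.finrank ℝ E)) → ℂ) :=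
    { toFun := fun η a => η (b ∘ a)
      map_add' := fun _ _ => rfl
      map_smul' := fun _ _ => rfl }
  have hev : LinearMap.ker ev = ⊥ := by
    rw [LinearMap.ker_eq_bot']
    intro η hη
    have h : η.toAlternatingMap = 0 :=
      Module.Basis.ext_alternating b fun a _ => congrFun hη a
    ext w
    exact congrArg (fun L => L w) h
  have : FiniteDimensional ℝ (E [⋀^Fin k]→L[ℝ] ℂ) :=
    FiniteDimensional.of_injective ev (LinearMap.ker_eq_bot.1 hev)
  -- Evaluation on tuples of basis vectors is injective, so a linear left inverse recovers the form
  -- from finitely many smooth values.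
  obtain ⟨g, hg⟩ := ev.exists_leftInverse_of_injective hev
  constructor
  · intro h w
    let L : (E [⋀^Fin k]→L[ℝ] ℂ) →ₗ[ℝ] ℂ :=
      { toFun := fun η => η w
        map_add' := fun _ _ => rfl
        map_smul' := fun _ _ => rfl }
    exact (LinearMap.toContinuousLinearMap L).contDiff.comp_contDiffOn h
  · intro h
    have h1 : ContDiffOn ℝ r (fun y => ev (F y)) s := contDiffOn_pi.2 fun a => h _
    have h2 := (LinearMap.toContinuousLinearMap g).contDiff.comp_contDiffOn h1
    refine h2.congr fun y _ => ?_
    exact (congrArg (fun L => L (F y)) hg).symm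

section Chart

variable {n : ℕ} {M : Type*} [TopologicalSpace M]
  [ChartedSpace (EuclideanSpace ℝ (Fin (2 * n))) M] [IsManifold (𝓡 (2 * n)) ∞ M]

theorem isInvertible_mfderiv_extChartAt_symm (x₀ : M) {y : EuclideanSpace ℝ (Fin (2 * n))}
    (hy : y ∈ (extChartAt (𝓡 (2 * n)) x₀).target) :
    (mfderiv 𝓘(ℝ, EuclideanSpace ℝ (Fin (2 * n))) (𝓡 (2 * n))
      (extChartAt (𝓡 (2 * n)) x₀).symm y).IsInvertible := by
  have h := isInvertible_mfderivWithin_extChartAt_symm (I := 𝓡 (2 * n)) hy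
  rwa [ModelWithCorners.range_eq_univ, mfderivWithin_univ] at h

theorem contMDiffAt_extChartAt_symm (x₀ : M) {y : EuclideanSpace ℝ (Fin (2 * n))}
    (hy : y ∈ (extChartAt (𝓡 (2 * n)) x₀).target) :
    ContMDiffAt 𝓘(ℝ, EuclideanSpace ℝ (Fin (2 * n))) (𝓡 (2 * n)) ∞
      (extChartAt (𝓡 (2 * n)) x₀).symm y :=
  (contMDiffOn_extChartAt_symm x₀).contMDiffAt ((isOpen_extChartAt_target x₀).mem_nhds hy)

theorem mfderiv_extChartAt_symm_mfderiv (x : M) (u : TangentSpace (𝓡 (2 * n)) x) :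
    mfderiv 𝓘(ℝ, EuclideanSpace ℝ (Fin (2 * n))) (𝓡 (2 * n)) (extChartAt (𝓡 (2 * n)) x).symm
      (extChartAt (𝓡 (2 * n)) x x)
      (mfderiv (𝓡 (2 * n)) 𝓘(ℝ, EuclideanSpace ℝ (Fin (2 * n))) (extChartAt (𝓡 (2 * n)) x) x u)
      = u := by
  have h := mfderivWithin_extChartAt_symm_comp_mfderiv_extChartAt' (I := 𝓡 (2 * n))
    (mem_extChartAt_source (I := 𝓡 (2 * n)) x)
  rw [ModelWithCorners.range_eq_univ, mfderivWithin_univ] at h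
  exact congrArg (fun L => L u) h

theorem differentiableAt_comp_extChartAt_symm {g : M → ℂ} (x₀ : M)
    {y : EuclideanSpace ℝ (Fin (2 * n))} (hy : y ∈ (extChartAt (𝓡 (2 * n)) x₀).target)
    (hg : MDifferentiableAt (𝓡 (2 * n)) 𝓘(ℝ, ℂ) g ((extChartAt (𝓡 (2 * n)) x₀).symm y)) :
    DifferentiableAt ℝ (fun z => g ((extChartAt (𝓡 (2 * n)) x₀).symm z)) y :=
  (hg.comp y ((contMDiffAt_extChartAt_symm x₀ hy).mdifferentiableAt (by simp))).differentiableAt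

/-- The derivative of the chart expression of a function. -/
theorem fderiv_comp_extChartAt_symm {g : M → ℂ} (x₀ : M)
    {y : EuclideanSpace ℝ (Fin (2 * n))} (hy : y ∈ (extChartAt (𝓡 (2 * n)) x₀).target)
    (hg : MDifferentiableAt (𝓡 (2 * n)) 𝓘(ℝ, ℂ) g ((extChartAt (𝓡 (2 * n)) x₀).symm y))
    (e : EuclideanSpace ℝ (Fin (2 * n))) :
    fderiv ℝ (fun z => g ((extChartAt (𝓡 (2 * n)) x₀).symm z)) y e
      = differential g ((extChartAt (𝓡 (2 * n)) x₀).symm y)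
        (mfderiv 𝓘(ℝ, EuclideanSpace ℝ (Fin (2 * n))) (𝓡 (2 * n))
          (extChartAt (𝓡 (2 * n)) x₀).symm y e) := by
  have h := (contMDiffAt_extChartAt_symm x₀ hy).mdifferentiableAt (by simp)
  rw [← mfderiv_eq_fderiv]
  exact congrArg (fun L => L e) (hg.hasMFDerivAt.comp y h.hasMFDerivAt).mfderiv

omit [IsManifold (𝓡 (2 * n)) ∞ M] in
theorem extDerivForm_apply {k : ℕ}
    (η : ∀ x : M, TangentSpace (𝓡 (2 * n)) x [⋀^Fin k]→L[ℝ] ℂ) (x : M)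
    (w : Fin (k + 1) → TangentSpace (𝓡 (2 * n)) x) :
    extDerivForm η x w = extDeriv (formInChart η x) (extChartAt (𝓡 (2 * n)) x x)
      (fun i => mfderiv (𝓡 (2 * n)) 𝓘(ℝ, EuclideanSpace ℝ (Fin (2 * n)))
        (extChartAt (𝓡 (2 * n)) x) x (w i)) := rfl

theorem formInChart_self {k : ℕ}
    (η : ∀ x : M, TangentSpace (𝓡 (2 * n)) x [⋀^Fin k]→L[ℝ] ℂ) (x : M)
    (w : Fin k → TangentSpace (𝓡 (2 * n)) x) :
    formInChart η x (extChartAt (𝓡 (2 * n)) x x)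
      (fun i => mfderiv (𝓡 (2 * n)) 𝓘(ℝ, EuclideanSpace ℝ (Fin (2 * n)))
        (extChartAt (𝓡 (2 * n)) x) x (w i)) = η x w := by
  -- Returning from the chart gives a point equal to x only propositionally. All tangent spaces are
  -- the same model space by definition, so the equality is stated there for a variable z and
  -- substituted.
  have h1 : ∀ z, z = x → ∀ u : Fin k → EuclideanSpace ℝ (Fin (2 * n)),
      (η z : EuclideanSpace ℝ (Fin (2 * n)) [⋀^Fin k]→L[ℝ] ℂ) u
        = (η x : EuclideanSpace ℝ (Fin (2 * n)) [⋀^Fin k]→L[ℝ] ℂ) u := by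
    rintro _ rfl _
    rfl
  refine (h1 _ (extChartAt_to_inv x) _).trans ?_
  congr 1
  exact funext fun i => mfderiv_extChartAt_symm_mfderiv x (w i)

omit [IsManifold (𝓡 (2 * n)) ∞ M] in
theorem IsSmoothFormOn.differentiableAt {k : ℕ}
    {η : ∀ x : M, TangentSpace (𝓡 (2 * n)) x [⋀^Fin k]→L[ℝ] ℂ} {U : Set M}
    (hη : IsSmoothFormOn η U) (hU : IsOpen U) {x : M} (hx : x ∈ U) :
    DifferentiableAt ℝ (formInChart η x) (extChartAt (𝓡 (2 * n)) x x) := by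
  refine ((hη x).contDiffAt ?_).differentiableAt (by simp)
  exact inter_mem (extChartAt_target_mem_nhds x)
    ((continuousAt_extChartAt_symm x).preimage_mem_nhds
      (by rw [extChartAt_to_inv]; exact hU.mem_nhds hx))

theorem extDerivForm_smul {k : ℕ}
    {σ τ : ∀ x : M, TangentSpace (𝓡 (2 * n)) x [⋀^Fin k]→L[ℝ] ℂ} {g : M → ℂ} {x : M}
    (hg : MDifferentiableAt (𝓡 (2 * n)) 𝓘(ℝ, ℂ) g x)
    (hσ : DifferentiableAt ℝ (formInChart σ x) (extChartAt (𝓡 (2 * n)) x x))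
    (h : ∀ᶠ z in 𝓝 x, τ z = g z • σ z) (w : Fin (k + 1) → TangentSpace (𝓡 (2 * n)) x) :
    extDerivForm τ x w = g x * extDerivForm σ x w +
      ∑ i : Fin (k + 1), (-1) ^ (i : ℕ) * (differential g x (w i) * σ x (i.removeNth w)) := by
  have hx : (extChartAt (𝓡 (2 * n)) x).symm (extChartAt (𝓡 (2 * n)) x x) = x :=
    extChartAt_to_inv x
  have hy := mem_extChartAt_target (I := 𝓡 (2 * n)) x
  have hloc : formInChart τ x =ᶠ[𝓝 (extChartAt (𝓡 (2 * n)) x x)]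
      fun y => g ((extChartAt (𝓡 (2 * n)) x).symm y) • formInChart σ x y := by
    have hc := continuousAt_extChartAt_symm (I := 𝓡 (2 * n)) x
    rw [ContinuousAt, hx] at hc
    filter_upwards [hc.eventually h] with y hy
    simp only [formInChart, hy]
    rfl
  have hgx : MDifferentiableAt (𝓡 (2 * n)) 𝓘(ℝ, ℂ) g
      ((extChartAt (𝓡 (2 * n)) x).symm (extChartAt (𝓡 (2 * n)) x x)) := by rwa [hx]
  have hgu : ∀ u : TangentSpace (𝓡 (2 * n)) x,
      fderiv ℝ (fun y => g ((extChartAt (𝓡 (2 * n)) x).symm y)) (extChartAt (𝓡 (2 * n)) x x)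
        (mfderiv (𝓡 (2 * n)) 𝓘(ℝ, EuclideanSpace ℝ (Fin (2 * n))) (extChartAt (𝓡 (2 * n)) x) x u)
        = differential g x u := by
    intro u
    refine (fderiv_comp_extChartAt_symm x hy hgx _).trans ?_
    have h1 : ∀ z, z = x → ∀ u : EuclideanSpace ℝ (Fin (2 * n)),
        (differential g z : EuclideanSpace ℝ (Fin (2 * n)) →L[ℝ] ℂ) u
          = (differential g x : EuclideanSpace ℝ (Fin (2 * n)) →L[ℝ] ℂ) u := by
      rintro _ rfl _
      rfl
    refine (h1 _ hx _).trans ?_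
    exact congrArg (differential g x) (mfderiv_extChartAt_symm_mfderiv x u)
  rw [extDerivForm_apply, hloc.extDeriv_eq]
  refine (extDeriv_smul_fun_apply
    (differentiableAt_comp_extChartAt_symm x hy hgx) hσ _).trans ?_
  congr 1
  · rw [hx]
    rfl
  · refine Finset.sum_congr rfl fun i _ => ?_
    congr 1
    exact congrArg₂ _ (hgu (w i)) (formInChart_self σ x (i.removeNth w))

/-- The Leibniz rule `∂̄(g σ) = ∂̄g ⊗ σ + g ∂̄σ`. -/
theorem delbarCanonical_smul (J : AlmostComplexStructure n M) {σ τ : ∀ x : M, CanonicalFiber J x}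
    {g : M → ℂ} {x : M} (hg : MDifferentiableAt (𝓡 (2 * n)) 𝓘(ℝ, ℂ) g x)
    (hσ : DifferentiableAt ℝ (formInChart (fun y => (σ y).1) x) (extChartAt (𝓡 (2 * n)) x x))
    (h : ∀ᶠ z in 𝓝 x, τ z = g z • σ z) (v : TangentSpace (𝓡 (2 * n)) x) :
    delbarCanonical J τ x v = delbarFun J g x v • σ x + g x • delbarCanonical J σ x v := by
  have hE := extDerivForm_smul (τ := fun y => (τ y).1) hg hσ
    (h.mono fun z hz => by rw [hz]; rfl)
  -- R is dg ∧ σ, whose contraction with v^{0,1} is ∂̄g(v) σ because σ has type (n,0).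
  set R := extDerivForm (fun y => (τ y).1) x - g x • extDerivForm (fun y => (σ y).1) x with hR
  have hRw : ∀ w, R w = ∑ i : Fin (n + 1),
      (-1) ^ (i : ℕ) * (differential g x (w i) * (σ x).1 (i.removeNth w)) := by
    intro w
    rw [hR, ContinuousAlternatingMap.sub_apply, hE w, ContinuousAlternatingMap.smul_apply,
      smul_eq_mul, add_sub_cancel_left]
  have h1 := interiorZeroOne_of_eq_sum (σ x).2 _ hRw v
  have h2 : extDerivForm (fun y => (τ y).1) x
      = R + g x • extDerivForm (fun y => (σ y).1) x := by rw [hR, sub_add_cancel]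
  refine Subtype.ext ?_
  change holoPart (J.toFun x) (interiorZeroOne (J.toFun x) (extDerivForm (fun y => (τ y).1) x) v)
    = delbarFun J g x v • (σ x).1 + g x • holoPart (J.toFun x)
      (interiorZeroOne (J.toFun x) (extDerivForm (fun y => (σ y).1) x) v)
  rw [h2, interiorZeroOne_add, interiorZeroOne_smul, holoPart_add, holoPart_smul, h1,
    holoPart_smul, holoPart_eq_self (σ x).2]
  rfl

/-- The chart expression of a smooth vector field is smooth. -/
theorem contDiffOn_inverse_mfderiv_extChartAt_symm {V : ∀ x : M, TangentSpace (𝓡 (2 * n)) x}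
    (hV : ContMDiff (𝓡 (2 * n)) (𝓡 (2 * n)).tangent ∞
      (fun x => (⟨x, V x⟩ : TangentBundle (𝓡 (2 * n)) M))) (x₀ : M) :
    ContDiffOn ℝ ∞ (fun y => (mfderiv 𝓘(ℝ, EuclideanSpace ℝ (Fin (2 * n))) (𝓡 (2 * n))
      (extChartAt (𝓡 (2 * n)) x₀).symm y).inverse (V ((extChartAt (𝓡 (2 * n)) x₀).symm y)) :
        EuclideanSpace ℝ (Fin (2 * n)) → EuclideanSpace ℝ (Fin (2 * n)))
      (extChartAt (𝓡 (2 * n)) x₀).target := by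
  intro y hy
  have h := ContMDiffAt.mpullback_vectorField_preimage (hV _)
    (contMDiffAt_extChartAt_symm x₀ hy) (isInvertible_mfderiv_extChartAt_symm x₀ hy)
    (m := ∞) (by simp)
  exact (contMDiffAt_vectorSpace_iff_contDiffAt.1 h).contDiffWithinAt

end Chart

/-! ### Smoothness of the dual coframe, of ψ and of J in charts -/

namespace StandardParallelism

variable {n : ℕ} {M : Type*} [TopologicalSpace M]
  [ChartedSpace (EuclideanSpace ℝ (Fin (2 * n))) M] [IsManifold (𝓡 (2 * n)) ∞ M]
  {J : AlmostComplexStructure n M} (P : StandardParallelism J)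

/-- The components in the chart around `x₀` of the vector fields of the parallelism. -/
def frameInChart (x₀ : M) (a : Fin n ⊕ Fin n) (y : EuclideanSpace ℝ (Fin (2 * n))) :
    EuclideanSpace ℝ (Fin (2 * n)) :=
  (mfderiv 𝓘(ℝ, EuclideanSpace ℝ (Fin (2 * n))) (𝓡 (2 * n))
    (extChartAt (𝓡 (2 * n)) x₀).symm y).inverse
      (Sum.elim P.v P.w a ((extChartAt (𝓡 (2 * n)) x₀).symm y))

theorem contDiffOn_frameInChart (x₀ : M) (a : Fin n ⊕ Fin n) :
    ContDiffOn ℝ ∞ (P.frameInChart x₀ a) (extChartAt (𝓡 (2 * n)) x₀).target :=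
  contDiffOn_inverse_mfderiv_extChartAt_symm
    (contMDiffOn_univ.1 (P.isFrame.contMDiffOn a)) x₀

/-- The components of a coordinate vector field in the parallelism. -/
def coordInChart (x₀ : M) (a : Fin n ⊕ Fin n) (e y : EuclideanSpace ℝ (Fin (2 * n))) : ℝ :=
  (P.basis ((extChartAt (𝓡 (2 * n)) x₀).symm y)).coord a
    (mfderiv 𝓘(ℝ, EuclideanSpace ℝ (Fin (2 * n))) (𝓡 (2 * n))
      (extChartAt (𝓡 (2 * n)) x₀).symm y e)

theorem basis_apply (x : M) (a : Fin n ⊕ Fin n) : P.basis x a = Sum.elim P.v P.w a x := by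
  cases a with
  | inl i => exact P.basis_inl i x
  | inr i => exact P.basis_inr i x

theorem contDiffOn_coordInChart (x₀ : M) (a : Fin n ⊕ Fin n)
    (e : EuclideanSpace ℝ (Fin (2 * n))) :
    ContDiffOn ℝ ∞ (P.coordInChart x₀ a e) (extChartAt (𝓡 (2 * n)) x₀).target := by
  -- A(y) maps coefficients to the corresponding combination of frame vectors. The dual coordinates
  -- are the components of A(y)⁻¹ e, smooth because inversion of operators is.
  let A : EuclideanSpace ℝ (Fin (2 * n)) →
      ((Fin n ⊕ Fin n → ℝ) →L[ℝ] EuclideanSpace ℝ (Fin (2 * n))) := fun y =>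
    ∑ a, (ContinuousLinearMap.proj a : (Fin n ⊕ Fin n → ℝ) →L[ℝ] ℝ).smulRight
      (P.frameInChart x₀ a y)
  have hA : ContDiffOn ℝ ∞ A (extChartAt (𝓡 (2 * n)) x₀).target := by
    refine contDiffOn_clm_apply.2 fun c => ?_
    have h1 : (fun y => A y c) = fun y => ∑ a, c a • P.frameInChart x₀ a y := by
      ext1 y
      simp [A]
    rw [h1]
    exact ContDiffOn.sum fun a _ =>
      (contDiffOn_const (c := c a)).smul (P.contDiffOn_frameInChart x₀ a)
  have key : ∀ y ∈ (extChartAt (𝓡 (2 * n)) x₀).target, (A y).IsInvertible ∧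
      P.coordInChart x₀ a e y = (A y).inverse e a := by
    intro y hy
    obtain ⟨S, hS⟩ := isInvertible_mfderiv_extChartAt_symm x₀ hy
    let B : (Fin n ⊕ Fin n → ℝ) ≃ₗ[ℝ] EuclideanSpace ℝ (Fin (2 * n)) :=
      (P.basis ((extChartAt (𝓡 (2 * n)) x₀).symm y)).equivFun.symm.trans S.symm.toLinearEquiv
    have hAB : A y = (B.toContinuousLinearEquiv :
        (Fin n ⊕ Fin n → ℝ) →L[ℝ] EuclideanSpace ℝ (Fin (2 * n))) := by
      ext1 c
      have h1 : A y c = ∑ a, c a • P.frameInChart x₀ a y := by simp [A]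
      have h2 : B c = S.symm (∑ a, c a • P.basis ((extChartAt (𝓡 (2 * n)) x₀).symm y) a) := by
        rw [← Module.Basis.equivFun_symm_apply]
        rfl
      rw [h1]
      refine Eq.trans ?_ h2.symm
      rw [map_sum]
      refine Finset.sum_congr rfl fun a _ => ?_
      rw [map_smul, basis_apply, frameInChart, ← hS, ContinuousLinearMap.inverse_equiv]
      rfl
    refine ⟨⟨_, hAB.symm⟩, ?_⟩
    rw [hAB, ContinuousLinearMap.inverse_equiv, coordInChart, ← hS]
    rfl
  intro y hy
  have h1 : ContDiffWithinAt ℝ ∞ (fun z => (A z).inverse) (extChartAt (𝓡 (2 * n)) x₀).target y :=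
    ((key y hy).1.contDiffAt_map_inverse).comp_contDiffWithinAt y (hA y hy)
  have h2 := contDiffWithinAt_pi.1 (h1.clm_apply (contDiffWithinAt_const (c := e))) a
  exact h2.congr (fun z hz => (key z hz).2) (key y hy).2

theorem isSmoothFormOn_psi : IsSmoothFormOn (fun x => (P.psi x).1) univ := by
  intro x₀
  rw [preimage_univ, inter_univ, contDiffOn_continuousAlternatingMap_iff]
  intro w
  have hphi : ∀ i e, ContDiffOn ℝ ∞ (fun y => (P.coordInChart x₀ (Sum.inl i) e y : ℂ)
      + (P.coordInChart x₀ (Sum.inr i) e y : ℂ) * Complex.I)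
        (extChartAt (𝓡 (2 * n)) x₀).target := fun i e =>
    (Complex.ofRealCLM.contDiff.comp_contDiffOn (P.contDiffOn_coordInChart x₀ _ e)).add
      ((Complex.ofRealCLM.contDiff.comp_contDiffOn (P.contDiffOn_coordInChart x₀ _ e)).mul
        contDiffOn_const)
  have hpsi : ∀ y, formInChart (fun x => (P.psi x).1) x₀ y w
      = ∑ s : Equiv.Perm (Fin n), ((Equiv.Perm.sign s : ℤ) : ℂ) *
        ∏ i, ((P.coordInChart x₀ (Sum.inl i) (w (s i)) y : ℂ)
          + (P.coordInChart x₀ (Sum.inr i) (w (s i)) y : ℂ) * Complex.I) := by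
    intro y
    refine (Matrix.det_apply' _).trans ?_
    refine Finset.sum_congr rfl fun s _ => ?_
    congr 1
    refine Finset.prod_congr rfl fun i _ => ?_
    exact P.phi_apply i _ _
  simp only [hpsi]
  exact ContDiffOn.sum fun s _ => contDiffOn_const.mul (contDiffOn_prod fun i _ => hphi i _)

theorem psi_apply_v (x : M) : (P.psi x).1 (fun i => P.v i x) = 1 := by
  change (Matrix.of fun j i => P.phi i x (P.v j x)).det = 1
  have h : (Matrix.of fun j i => P.phi i x (P.v j x)) = (1 : Matrix (Fin n) (Fin n) ℂ) := by
    ext j i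
    rw [Matrix.of_apply, P.phi_apply, ← P.basis_inl, Module.Basis.coord_apply,
      Module.Basis.coord_apply, Module.Basis.repr_self]
    by_cases hij : j = i <;> simp [Matrix.one_apply, hij]
  rw [h, Matrix.det_one]

theorem psi_ne_zero (x : M) : P.psi x ≠ 0 := by
  intro h
  have := P.psi_apply_v x
  rw [h] at this
  simp at this

theorem isCanonicalFrameOn_psi : IsCanonicalFrameOn J P.psi univ :=
  ⟨P.isSmoothFormOn_psi, fun x _ => P.psi_ne_zero x⟩

theorem span_v_Jv (x : M) : Submodule.span ℝ
    (range (fun i => P.v i x) ∪ range (J.toFun x ∘ fun i => P.v i x)) = ⊤ := by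
  have h : range (fun i => P.v i x) ∪ range (J.toFun x ∘ fun i => P.v i x)
      = range (P.basis x) := by
    rw [← Sum.elim_range]
    congr 1
    ext1 a
    cases a with
    | inl i => exact (P.basis_inl i x).symm
    | inr i => exact (P.J_v i x).trans (P.basis_inr i x).symm
  rw [h, Module.Basis.span_eq]

theorem eq_smul_psi (x : M) (σ : CanonicalFiber J x) :
    σ = σ.1 (fun i => P.v i x) • P.psi x :=
  Subtype.ext (typeZero_eq_smul (P.span_v_Jv x) σ.2 (P.psi x).2 (P.psi_apply_v x))

/-- The chart expression of the almost complex structure. -/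
def complexStructureInChart (J : AlmostComplexStructure n M) (x₀ : M)
    (y : EuclideanSpace ℝ (Fin (2 * n))) :
    EuclideanSpace ℝ (Fin (2 * n)) →L[ℝ] EuclideanSpace ℝ (Fin (2 * n)) :=
  (mfderiv 𝓘(ℝ, EuclideanSpace ℝ (Fin (2 * n))) (𝓡 (2 * n))
    (extChartAt (𝓡 (2 * n)) x₀).symm y).inverse ∘L
      (J.toFun ((extChartAt (𝓡 (2 * n)) x₀).symm y) ∘L
        mfderiv 𝓘(ℝ, EuclideanSpace ℝ (Fin (2 * n))) (𝓡 (2 * n))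
          (extChartAt (𝓡 (2 * n)) x₀).symm y)

include P in
-- J has constant coefficients in the parallelism, so its chart expression is a combination of
-- smooth frame fields with smooth coframe coefficients.
theorem contDiffOn_complexStructureInChart (x₀ : M) :
    ContDiffOn ℝ ∞ (complexStructureInChart J x₀) (extChartAt (𝓡 (2 * n)) x₀).target := by
  refine contDiffOn_clm_apply.2 fun e => ?_
  have h : ∀ y, complexStructureInChart J x₀ y e =
      ∑ i, P.coordInChart x₀ (Sum.inl i) e y • P.frameInChart x₀ (Sum.inr i) y
        - ∑ i, P.coordInChart x₀ (Sum.inr i) e y • P.frameInChart x₀ (Sum.inl i) y := by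
    intro y
    set x := (extChartAt (𝓡 (2 * n)) x₀).symm y with hx
    set S := mfderiv 𝓘(ℝ, EuclideanSpace ℝ (Fin (2 * n))) (𝓡 (2 * n))
          (extChartAt (𝓡 (2 * n)) x₀).symm y with hS
    have h1 : J.toFun x (S e) = ∑ i, (P.basis x).coord (Sum.inl i) (S e) • P.w i x
        - ∑ i, (P.basis x).coord (Sum.inr i) (S e) • P.v i x := by
      conv_lhs => rw [← (P.basis x).sum_repr (S e)]
      rw [Fintype.sum_sum_type, map_add, map_sum, map_sum, sub_eq_add_neg,
        ← Finset.sum_neg_distrib]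
      simp only [map_smul, basis_inl, basis_inr, P.J_v, P.J_w, smul_neg]
      rfl
    have h2 : complexStructureInChart J x₀ y e = S.inverse (J.toFun x (S e)) := rfl
    rw [h2, h1, map_sub, map_sum, map_sum]
    simp only [map_smul]
    rfl
  simp only [h]
  exact (ContDiffOn.sum fun i _ => (P.contDiffOn_coordInChart x₀ _ e).smul
    (P.contDiffOn_frameInChart x₀ _)).sub (ContDiffOn.sum fun i _ =>
      (P.contDiffOn_coordInChart x₀ _ e).smul (P.contDiffOn_frameInChart x₀ _))

end StandardParallelism

end AlmostComplex

end

noncomputable section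

namespace AlmostComplex

theorem eq_smul_of_smul_add_smul_eq_zero {K W : Type*} [Field K] [AddCommGroup W] [Module K W]
    {a c : K} (hc : c ≠ 0) {s t : W} (h : a • s + c • t = 0) : t = (-c⁻¹ * a) • s := by
  rw [← inv_smul_smul₀ hc t, eq_neg_of_add_eq_zero_right h, smul_neg, smul_smul, neg_mul, neg_smul]

/-! ### Leibniz rules for products, powers and tensor powers -/

section Leibniz

variable {n : ℕ} {M : Type*} [TopologicalSpace M]
  [ChartedSpace (EuclideanSpace ℝ (Fin (2 * n))) M]

theorem differential_mul {f g : M → ℂ} {x : M}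
    (hf : MDifferentiableAt (𝓡 (2 * n)) 𝓘(ℝ, ℂ) f x)
    (hg : MDifferentiableAt (𝓡 (2 * n)) 𝓘(ℝ, ℂ) g x) (v : TangentSpace (𝓡 (2 * n)) x) :
    differential (n := n) (f * g) x v = f x * differential g x v + g x * differential f x v :=
  congrArg (fun L => L v) (hf.hasMFDerivAt.mul hg.hasMFDerivAt).mfderiv

variable [IsManifold (𝓡 (2 * n)) ∞ M] (J : AlmostComplexStructure n M)

theorem delbarFun_mul {f g : M → ℂ} {x : M}
    (hf : MDifferentiableAt (𝓡 (2 * n)) 𝓘(ℝ, ℂ) f x)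
    (hg : MDifferentiableAt (𝓡 (2 * n)) 𝓘(ℝ, ℂ) g x) (v : TangentSpace (𝓡 (2 * n)) x) :
    delbarFun J (f * g) x v = f x * delbarFun J g x v + g x * delbarFun J f x v := by
  simp only [delbarFun, differential_mul hf hg]
  ring

theorem delbarFun_const (c : ℂ) (x : M) (v : TangentSpace (𝓡 (2 * n)) x) :
    delbarFun J (fun _ => c) x v = 0 := by
  have h : differential (n := n) (fun _ : M => c) x = 0 := mfderiv_const
  rw [delbarFun, h]
  change (1 / 2 : ℂ) * ((0 : ℂ) + Complex.I * (0 : ℂ)) = 0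
  simp

omit [IsManifold (𝓡 (2 * n)) ∞ M] in
theorem mdifferentiableAt_pow {g : M → ℂ} {x : M}
    (hg : MDifferentiableAt (𝓡 (2 * n)) 𝓘(ℝ, ℂ) g x) (m : ℕ) :
    MDifferentiableAt (𝓡 (2 * n)) 𝓘(ℝ, ℂ) (g ^ m) x := by
  induction m with
  | zero => exact mdifferentiableAt_const (c := (1 : ℂ))
  | succ m ih =>
    rw [pow_succ]
    exact (ih.hasMFDerivAt.mul hg.hasMFDerivAt).mdifferentiableAt

/-- The extra factor g x avoids the exponent m - 1, so m = 0 needs no separate form. -/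
theorem delbarFun_pow {g : M → ℂ} {x : M} (hg : MDifferentiableAt (𝓡 (2 * n)) 𝓘(ℝ, ℂ) g x)
    (m : ℕ) (v : TangentSpace (𝓡 (2 * n)) x) :
    g x * delbarFun J (g ^ m) x v = m * g x ^ m * delbarFun J g x v := by
  induction m with
  | zero =>
    have h : delbarFun J (g ^ 0) x v = 0 := delbarFun_const J 1 x v
    rw [h]
    simp
  | succ m ih =>
    rw [pow_succ, delbarFun_mul J (mdifferentiableAt_pow hg m) hg, Pi.pow_apply]
    push_cast
    linear_combination g x * ih

theorem differential_J_of_delbarFun_eq_zero {f : M → ℂ} {x : M} {v : TangentSpace (𝓡 (2 * n)) x}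
    (h : delbarFun J f x v = 0) :
    differential f x (J.toFun x v) = Complex.I * differential f x v := by
  unfold delbarFun at h
  linear_combination (-2 * Complex.I) * h + differential f x (J.toFun x v) * Complex.I_mul_I

theorem tensorPow_smul (m : ℕ) {σ τ : ∀ x : M, CanonicalFiber J x} {x : M} {c : ℂ}
    (h : τ x = c • σ x) : tensorPow J m τ x = c ^ m • tensorPow J m σ x := by
  simp only [tensorPow, h]
  rw [MultilinearMap.map_smul_univ]
  simp

theorem delbarTensorPow_of_eq_smul (m : ℕ) {σ : ∀ x : M, CanonicalFiber J x} {x : M}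
    {v : TangentSpace (𝓡 (2 * n)) x} {c : ℂ} (h : delbarCanonical J σ x v = c • σ x) :
    delbarTensorPow J m σ x v = (m * c) • tensorPow J m σ x := by
  have h1 : ∀ i : Fin m, PiTensorProduct.tprod ℂ
      (update (fun _ : Fin m => σ x) i (delbarCanonical J σ x v)) = c • tensorPow J m σ x := by
    intro i
    rw [h, MultilinearMap.map_update_smul, update_eq_self_iff.2 rfl]
    rfl
  rw [delbarTensorPow, Finset.sum_congr rfl fun i _ => h1 i]
  simp [mul_smul, Nat.cast_smul_eq_nsmul]

end Leibniz

/-! ### Constancy of ∂̄-closed functions -/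

namespace StandardParallelism

variable {n : ℕ} {M : Type*} [TopologicalSpace M]
  [ChartedSpace (EuclideanSpace ℝ (Fin (2 * n))) M] [IsManifold (𝓡 (2 * n)) ∞ M]
  {J : AlmostComplexStructure n M} (P : StandardParallelism J)

/-- Evaluating each tensor factor at (v₁, …, v_n) and multiplying gives such a functional. It
certifies ψ^{⊗m} ≠ 0 and yields injectivity of f ↦ f ψ^{⊗m}. -/
theorem exists_linearMap_tensorPow_psi (m : ℕ) (x : M) :
    ∃ L : PluriFiber J m x →ₗ[ℂ] ℂ, L (tensorPow J m P.psi x) = 1 := by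
  let ev : CanonicalFiber J x →ₗ[ℂ] ℂ :=
    { toFun := fun η => η.1 (fun i => P.v i x)
      map_add' := fun _ _ => rfl
      map_smul' := fun _ _ => rfl }
  refine ⟨PiTensorProduct.lift ((MultilinearMap.mkPiAlgebra ℂ (Fin m) ℂ).compLinearMap
    fun _ => ev), ?_⟩
  rw [tensorPow, PiTensorProduct.lift.tprod]
  have h : ev (P.psi x) = 1 := P.psi_apply_v x
  simp [h]

theorem tensorPow_psi_ne_zero (m : ℕ) (x : M) : tensorPow J m P.psi x ≠ 0 := by
  intro h
  obtain ⟨L, hL⟩ := P.exists_linearMap_tensorPow_psi m x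
  rw [h, map_zero] at hL
  exact zero_ne_one hL

include P in
theorem eventually_re_eq {f : M → ℂ} (hf : f ∈ holoFunctions J) {m : ℝ}
    (hle : ∀ x, (f x).re ≤ m) {x₀ : M} (hx₀ : (f x₀).re = m) : ∀ᶠ x in 𝓝 x₀, (f x).re = m := by
  have hsymm : ∀ y ∈ (extChartAt (𝓡 (2 * n)) x₀).target, ContMDiffAt
      𝓘(ℝ, EuclideanSpace ℝ (Fin (2 * n))) 𝓘(ℝ, ℂ) ∞
        (fun y => f ((extChartAt (𝓡 (2 * n)) x₀).symm y)) y := fun y hy =>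
    (hf.1 _).comp y (contMDiffAt_extChartAt_symm x₀ hy)
  have h := eventually_re_eq_of_delbar (isOpen_extChartAt_target (I := 𝓡 (2 * n)) x₀)
    (f := fun y => f ((extChartAt (𝓡 (2 * n)) x₀).symm y))
    (fun y hy => ((hsymm y hy).contDiffAt.of_le ENat.LEInfty.out).contDiffWithinAt)
    ((P.contDiffOn_complexStructureInChart x₀).of_le (by exact_mod_cast le_top))
    ?_ (fun y _ => hle _) (mem_extChartAt_target x₀)
    (by rw [extChartAt_to_inv]; exact hx₀)
  · filter_upwards [(continuousAt_extChartAt (I := 𝓡 (2 * n)) x₀).eventually h,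
      extChartAt_source_mem_nhds (I := 𝓡 (2 * n)) x₀] with x hx hxs
    rwa [(extChartAt (𝓡 (2 * n)) x₀).left_inv hxs] at hx
  · intro y hy e
    have hfd := (hf.1 ((extChartAt (𝓡 (2 * n)) x₀).symm y)).mdifferentiableAt (by simp)
    rw [fderiv_comp_extChartAt_symm x₀ hy hfd, fderiv_comp_extChartAt_symm x₀ hy hfd,
      ← differential_J_of_delbarFun_eq_zero J (hf.2 _ _)]
    refine congrArg (differential f _) ?_
    obtain ⟨S, hS⟩ := isInvertible_mfderiv_extChartAt_symm x₀ hy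
    rw [complexStructureInChart, ← hS, ContinuousLinearMap.inverse_equiv]
    exact S.apply_symm_apply _

include P in
theorem exists_re_eq [CompactSpace M] [ConnectedSpace M] {f : M → ℂ} (hf : f ∈ holoFunctions J) :
    ∃ m, ∀ x, (f x).re = m := by
  have hc : Continuous fun x => (f x).re := Complex.continuous_re.comp hf.1.continuous
  obtain ⟨x₀, -, hx₀⟩ := isCompact_univ.exists_isMaxOn univ_nonempty hc.continuousOn
  refine ⟨(f x₀).re, fun x => ?_⟩
  have hclopen : IsClopen {x | (f x).re = (f x₀).re} := by
    refine ⟨isClosed_eq hc continuous_const, isOpen_iff_mem_nhds.2 fun y hy => ?_⟩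
    exact P.eventually_re_eq hf (fun z => hx₀ (mem_univ z)) hy
  exact (hclopen.eq_univ ⟨x₀, rfl⟩).ge (mem_univ x)

include P in
/-- On a compact connected almost complex manifold every function with `∂̄f = 0` is constant. -/
theorem exists_eq_const [CompactSpace M] [ConnectedSpace M] {f : M → ℂ}
    (hf : f ∈ holoFunctions J) : ∃ c, ∀ x, f x = c := by
  obtain ⟨a, ha⟩ := P.exists_re_eq hf
  -- The real part of -if is Im f.
  obtain ⟨b, hb⟩ := P.exists_re_eq ((holoFunctions J).smul_mem (-Complex.I) hf)
  refine ⟨⟨a, b⟩, fun x => Complex.ext (ha x) ?_⟩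
  rw [← hb x]
  simp

include P in
theorem rank_holoFunctions [CompactSpace M] [ConnectedSpace M] :
    Module.rank ℂ (holoFunctions J) = 1 := by
  refine rank_eq_one (⟨fun _ => 1, contMDiff_const, delbarFun_const J 1⟩ : holoFunctions J) ?_ ?_
  · intro h
    obtain ⟨x⟩ := (inferInstance : Nonempty M)
    exact one_ne_zero (congrFun (congrArg Subtype.val h) x)
  · rintro ⟨f, hf⟩
    obtain ⟨c, hc⟩ := P.exists_eq_const hf
    refine ⟨c, Subtype.ext (funext fun x => ?_)⟩
    simp [hc x]

/-! ### Sections of ω_X^{⊗m} as multiples of ψ^{⊗m} -/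

/-- The coefficient of a smooth section of `ω_X` with respect to `ψ` is smooth. -/
theorem contMDiffOn_coeff {σ : ∀ x : M, CanonicalFiber J x} {U : Set M} (hU : IsOpen U)
    (hσ : IsSmoothFormOn (fun x => (σ x).1) U) :
    ContMDiffOn (𝓡 (2 * n)) 𝓘(ℝ, ℂ) ∞ (fun x => (σ x).1 (fun i => P.v i x)) U := by
  intro x₀ hx₀
  -- These vectors stay constant in the chart and agree with the v_i at x₀. Near x₀ the coefficient
  -- is the quotient σ(w)/ψ(w), whose denominator is 1 at x₀.
  set w : Fin n → EuclideanSpace ℝ (Fin (2 * n)) := fun i =>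
    mfderiv (𝓡 (2 * n)) 𝓘(ℝ, EuclideanSpace ℝ (Fin (2 * n))) (extChartAt (𝓡 (2 * n)) x₀) x₀
      (P.v i x₀) with hw
  have hnhds : (extChartAt (𝓡 (2 * n)) x₀).target ∩ (extChartAt (𝓡 (2 * n)) x₀).symm ⁻¹' U
      ∈ 𝓝 (extChartAt (𝓡 (2 * n)) x₀ x₀) :=
    inter_mem (extChartAt_target_mem_nhds x₀)
      ((continuousAt_extChartAt_symm x₀).preimage_mem_nhds
        (by rw [extChartAt_to_inv]; exact hU.mem_nhds hx₀))
  have hσw : ContDiffAt ℝ ∞ (fun y => formInChart (fun x => (σ x).1) x₀ y w)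
      (extChartAt (𝓡 (2 * n)) x₀ x₀) :=
    (contDiffOn_continuousAlternatingMap_iff.1 (hσ x₀) w).contDiffAt hnhds
  have hψw : ContDiffAt ℝ ∞ (fun y => formInChart (fun x => (P.psi x).1) x₀ y w)
      (extChartAt (𝓡 (2 * n)) x₀ x₀) :=
    (contDiffOn_continuousAlternatingMap_iff.1 (P.isSmoothFormOn_psi x₀) w).contDiffAt
      (mem_of_superset hnhds (inter_subset_inter_right _ (subset_univ _)))
  have hψ1 : formInChart (fun x => (P.psi x).1) x₀ (extChartAt (𝓡 (2 * n)) x₀ x₀) w = 1 :=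
    (formInChart_self _ x₀ _).trans (P.psi_apply_v x₀)
  have hψ0 : formInChart (fun x => (P.psi x).1) x₀ (extChartAt (𝓡 (2 * n)) x₀ x₀) w ≠ 0 := by
    rw [hψ1]; exact one_ne_zero
  have hq : ContMDiffAt (𝓡 (2 * n)) 𝓘(ℝ, ℂ) ∞ (fun x =>
      formInChart (fun x => (σ x).1) x₀ (extChartAt (𝓡 (2 * n)) x₀ x) w
        * (formInChart (fun x => (P.psi x).1) x₀ (extChartAt (𝓡 (2 * n)) x₀ x) w)⁻¹) x₀ :=
    (hσw.mul (hψw.inv hψ0)).contMDiffAt.comp x₀ contMDiffAt_extChartAt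
  refine (hq.congr_of_eventuallyEq ?_).contMDiffWithinAt
  have hne := (continuousAt_extChartAt (I := 𝓡 (2 * n)) x₀).eventually
    (hψw.continuousAt.eventually_ne hψ0)
  filter_upwards [hne, extChartAt_source_mem_nhds (I := 𝓡 (2 * n)) x₀] with x hx hxs
  rw [← div_eq_mul_inv, eq_div_iff hx]
  have h1 : ∀ z, z = x → (σ x).1 (fun i => P.v i x) = (σ z).1 (fun i => P.v i z) := by
    rintro _ rfl
    rfl
  rw [h1 _ ((extChartAt (𝓡 (2 * n)) x₀).left_inv hxs)]
  set y := extChartAt (𝓡 (2 * n)) x₀ x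
  have h2 := congrArg Subtype.val
    (P.eq_smul_psi ((extChartAt (𝓡 (2 * n)) x₀).symm y) (σ ((extChartAt (𝓡 (2 * n)) x₀).symm y)))
  exact (congrArg (fun η => η fun i => mfderiv 𝓘(ℝ, EuclideanSpace ℝ (Fin (2 * n))) (𝓡 (2 * n))
    (extChartAt (𝓡 (2 * n)) x₀).symm y (w i)) h2).symm

theorem smul_tensorPow_mem (hψ : ∀ (x : M) (u : TangentSpace (𝓡 (2 * n)) x),
      delbarCanonical J P.psi x u = 0) (m : ℕ) {f : M → ℂ} (hf : f ∈ holoFunctions J) :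
    (fun x => f x • tensorPow J m P.psi x) ∈ pluriSections J m := by
  intro U σ hU hσ
  set h : M → ℂ := fun x => (σ x).1 (fun i => P.v i x) with hh
  have hσψ : ∀ x, σ x = h x • P.psi x := fun x => P.eq_smul_psi x (σ x)
  have hne : ∀ x ∈ U, h x ≠ 0 := fun x hx h0 => hσ.2 x hx (by rw [hσψ, h0, zero_smul])
  have hsm : ContMDiffOn (𝓡 (2 * n)) 𝓘(ℝ, ℂ) ∞ h U := P.contMDiffOn_coeff hU hσ.1
  set g : M → ℂ := fun x => (h x)⁻¹ with hg
  have hψσ : ∀ x ∈ U, P.psi x = g x • σ x := fun x hx => by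
    rw [hσψ x, smul_smul, inv_mul_cancel₀ (hne x hx), one_smul]
  have hgsm : ContMDiffOn (𝓡 (2 * n)) 𝓘(ℝ, ℂ) ∞ g U := fun x hx =>
    ((contDiffAt_inv ℝ (hne x hx)).contMDiffAt).comp_contMDiffWithinAt x (hsm x hx)
  have hgm : ContMDiffOn (𝓡 (2 * n)) 𝓘(ℝ, ℂ) ∞ (g ^ m) U := fun x hx =>
    ((contDiff_id.pow m : ContDiff ℝ ∞ fun z : ℂ => z ^ m).contMDiff _).comp_contMDiffWithinAt x
      (hgsm x hx)
  -- On U, ψ = g σ, so the coefficient in the frame σ is f g^m.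
  refine ⟨f * g ^ m, contDiff_mul.contMDiff.comp_contMDiffOn (hf.1.contMDiffOn.prodMk_space hgm), fun x hx => ?_, fun x hx v => ?_⟩
  · change f x • tensorPow J m P.psi x = _
    rw [tensorPow_smul J m (hψσ x hx), smul_smul]
    rfl
  · have hgx : g x ≠ 0 := inv_ne_zero (hne x hx)
    have hgd : MDifferentiableAt (𝓡 (2 * n)) 𝓘(ℝ, ℂ) g x :=
      (hgsm.contMDiffAt (hU.mem_nhds hx)).mdifferentiableAt (by simp)
    have hL := delbarCanonical_smul J hgd (hσ.1.differentiableAt hU hx)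
      (by filter_upwards [hU.mem_nhds hx] with z hz using hψσ z hz) v
    rw [hψ] at hL
    -- From 0 = ∂̄ψ = ∂̄g ⊗ σ + g ∂̄σ. The m equal terms of ∂̄(σ^{⊗m}) then cancel ∂̄(g^m).
    have hσd : delbarCanonical J σ x v = (-(g x)⁻¹ * delbarFun J g x v) • σ x :=
      eq_smul_of_smul_add_smul_eq_zero (W := CanonicalFiber J x) hgx hL.symm
    rw [delbarTensorPow_of_eq_smul J m hσd, smul_smul, ← add_smul,
      delbarFun_mul J (hf.1.mdifferentiable (by simp) x) (mdifferentiableAt_pow hgd m), hf.2,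
      mul_zero, add_zero, Pi.mul_apply, Pi.pow_apply]
    have hp := delbarFun_pow J hgd m v
    have h0 : f x * delbarFun J (g ^ m) x v
        + f x * g x ^ m * (m * (-(g x)⁻¹ * delbarFun J g x v)) = 0 := by
      have : delbarFun J (g ^ m) x v = (g x)⁻¹ * (m * g x ^ m * delbarFun J g x v) := by
        rw [← hp, inv_mul_cancel_left₀ hgx]
      rw [this]
      ring
    rw [h0, zero_smul]

theorem exists_eq_smul_tensorPow (hψ : ∀ (x : M) (u : TangentSpace (𝓡 (2 * n)) x),
      delbarCanonical J P.psi x u = 0) (m : ℕ) {s : ∀ x : M, PluriFiber J m x}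
    (hs : s ∈ pluriSections J m) :
    ∃ f ∈ holoFunctions J, ∀ x, s x = f x • tensorPow J m P.psi x := by
  -- The global frame ψ is itself one of the frames in which `HasDelbar` is tested.
  obtain ⟨f, hf, hsf, hd⟩ := hs univ P.psi isOpen_univ P.isCanonicalFrameOn_psi
  refine ⟨f, ⟨contMDiffOn_univ.1 hf, fun x v => ?_⟩, fun x => hsf x (mem_univ x)⟩
  have h := hd x (mem_univ x) v
  rw [delbarTensorPow_of_eq_smul J m (c := 0) (by rw [hψ, zero_smul]), mul_zero, zero_smul,
    smul_zero, add_zero] at h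
  exact (smul_eq_zero.1 h.symm).resolve_right (P.tensorPow_psi_ne_zero m x)

/-- The linear map `f ↦ f ψ^{⊗m}`. -/
def pluriMap (hψ : ∀ (x : M) (u : TangentSpace (𝓡 (2 * n)) x), delbarCanonical J P.psi x u = 0)
    (m : ℕ) : holoFunctions J →ₗ[ℂ] pluriSections J m where
  toFun f := ⟨fun x => f.1 x • tensorPow J m P.psi x, P.smul_tensorPow_mem hψ m f.2⟩
  map_add' f g := Subtype.ext (funext fun x => add_smul (f.1 x) (g.1 x) _)
  map_smul' c f := Subtype.ext (funext fun x => mul_smul c (f.1 x) _)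

theorem pluriMap_bijective (hψ : ∀ (x : M) (u : TangentSpace (𝓡 (2 * n)) x),
      delbarCanonical J P.psi x u = 0) (m : ℕ) : Bijective (P.pluriMap hψ m) := by
  refine ⟨fun f g hfg => Subtype.ext (funext fun x => ?_), fun s => ?_⟩
  · obtain ⟨L, hL⟩ := P.exists_linearMap_tensorPow_psi m x
    have h : f.1 x • tensorPow J m P.psi x = g.1 x • tensorPow J m P.psi x :=
      congrFun (congrArg Subtype.val hfg) x
    simpa [hL] using congrArg L h
  · obtain ⟨f, hf, hsf⟩ := P.exists_eq_smul_tensorPow hψ m s.2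
    exact ⟨⟨f, hf⟩, Subtype.ext (funext fun x => (hsf x).symm)⟩

/-- The isomorphism `f ↦ f ψ^{⊗m}`. -/
def pluriEquiv (hψ : ∀ (x : M) (u : TangentSpace (𝓡 (2 * n)) x),
      delbarCanonical J P.psi x u = 0) (m : ℕ) : holoFunctions J ≃ₗ[ℂ] pluriSections J m :=
  LinearEquiv.ofBijective (P.pluriMap hψ m) (P.pluriMap_bijective hψ m)

theorem rank_pluriSections [CompactSpace M] [ConnectedSpace M]
    (hψ : ∀ (x : M) (u : TangentSpace (𝓡 (2 * n)) x), delbarCanonical J P.psi x u = 0) (m : ℕ) :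
    Module.rank ℂ (pluriSections J m) = 1 := by
  rw [← (P.pluriEquiv hψ m).rank_eq, P.rank_holoFunctions]

end StandardParallelism

/-! ### Kodaira dimension and conclusion -/

theorem kodairaDim_eq_zero {n : ℕ} {M : Type*} [TopologicalSpace M]
    [ChartedSpace (EuclideanSpace ℝ (Fin (2 * n))) M] [IsManifold (𝓡 (2 * n)) ∞ M]
    {J : AlmostComplexStructure n M} (h : ∀ m, Module.rank ℂ (pluriSections J m) = 1) :
    kodairaDim J = 0 := by
  have hbot : ¬ ∀ m : ℕ, 1 ≤ m → pluriSections J m = ⊥ := by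
    intro hb
    have h1 := h 1
    rw [hb 1 le_rfl, rank_bot] at h1
    exact zero_ne_one h1
  rw [kodairaDim, if_neg hbot]
  -- The numerator is log 1 = 0, so every quotient is 0, including m = 0 and m = 1, where the
  -- denominators are ⊥ and 0.
  simp [plurigenus, h]

end AlmostComplex

end

open AlmostComplex in
theorem mainTheorem2 (n : ℕ) {M : Type*} [TopologicalSpace M] [T2Space M] [CompactSpace M]
    [ConnectedSpace M] [ChartedSpace (EuclideanSpace ℝ (Fin (2 * n))) M]
    [IsManifold (𝓡 (2 * n)) ∞ M] (J : AlmostComplexStructure n M) (P : StandardParallelism J)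
    (hψ : ∀ (x : M) (u : TangentSpace (𝓡 (2 * n)) x), delbarCanonical J P.psi x u = 0) :
    (∀ m : ℕ, 1 ≤ m →
      (∃ e : holoFunctions J ≃ₗ[ℂ] pluriSections J m,
        ∀ (f : holoFunctions J) (x : M), (e f).1 x = f.1 x • tensorPow J m P.psi x) ∧
      plurigenus J m = 1) ∧
    kodairaDim J = 0 := by
  refine ⟨fun m _ => ⟨⟨P.pluriEquiv hψ m, fun f x => rfl⟩, ?_⟩,
    kodairaDim_eq_zero (P.rank_pluriSections hψ)⟩
  rw [plurigenus, P.rank_pluriSections hψ m, map_one]
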